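/- Let $R=\bigoplus_{n\ge 0}R_n$ be a commutative Noetherian graded ring whose degree-zero part $R_0$ is a Noetherian local ring, and suppose that $R$ is generated as an $R_0$-algebra by finitely many elements of $R_1$. Let $\mathfrak a_0\subsetneq R_0$ be a proper ideal, $R_+=\bigoplus_{n>0}R_n$ and $\mathfrak a=\mathfrak a_0R+R_+$. Let $M=\bigoplus_{n\in\mathbb Z}M_n$ be a non-zero finitely generated graded $R$-module. For $i\ge 0$ let $H^i_{\mathfrak a}(M)$ be the $i$-th local cohomology module with its natural grading, that is, the $i$-th cohomology of the Čech complex of $M$ on any finite system of homogeneous generators of $\mathfrak a$, and let $H^i_{\mathfrak a}(M)_n$ be its component of degree $n\in\mathbb Z$. Let $f^{R_+}_{\mathfrak a}(M)\in\mathbb N_0\cup\{\infty\}$ be the least $i\ge 0$ such that $R_+\not\subseteq\sqrt{(0:_R H^i_{\mathfrak a}(M))}$, with $f^{R_+}_{\mathfrak a}(M)=\infty$ if there is no such $i$. If $f=f^{R_+}_{\mathfrak a}(M)<\infty$, then there is $n_0\in\mathbb Z$ such that $H^{f}_{\mathfrak a}(M)_n\ne 0$ for all $n\le n_0$. Moreover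 $$f^{R_+}_{\mathfrak a}(M)=\inf\{\,i\ge 0 : H^i_{\mathfrak a}(M)_n\neq 0\ \text{for all } n\ll 0\,\},$$ where $\inf\emptyset=\infty$. -/

import Mathlib

open scoped DirectSum

noncomputable section

/-- Compatibility of a `ℤ`-grading `ℳ` of an `R`-module with an `ℕ`-grading `𝒜` of the ring `R`:
`R_i • M_n ⊆ M_{i+n}`. -/
class GradedAction {R M : Type*} [CommRing R] [AddCommGroup M] [Module R M]
    (𝒜 : ℕ → AddSubgroup R) (ℳ : ℤ → AddSubgroup M) : Prop where
  smul_mem : ∀ {i : ℕ} {n : ℤ} {r : R} {m : M}, r ∈ 𝒜 i → m ∈ ℳ n → r • m ∈ ℳ ((i : ℤ) + n)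

/-- The ideal `𝔞 = 𝔞₀ R + R₊`. -/
def idealAddIrrelevant {R : Type*} [CommRing R] (𝒜 : ℕ → AddSubgroup R) [GradedRing 𝒜]
    (a₀ : Ideal (𝒜 0)) : Ideal R :=
  a₀.map (algebraMap (𝒜 0) R) ⊔ (HomogeneousIdeal.irrelevant 𝒜).toIdeal

/-- A finite system of homogeneous generators of an ideal. -/
structure IsHomogeneousGenerators {R : Type*} [CommRing R] (𝒜 : ℕ → AddSubgroup R)
    {r : ℕ} (x : Fin r → R) (J : Ideal R) : Prop where
  homogeneous : ∀ i, SetLike.IsHomogeneousElem 𝒜 (x i)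
  span_eq : Ideal.span (Set.range x) = J

/-! Local cohomology of `M` with support in the ideal generated by `x₁, …, x_r`, as the cohomology
of the Čech complex `0 → M → ⨁ᵢ M_{xᵢ} → ⨁_{i<j} M_{xᵢxⱼ} → ⋯ → M_{x₁⋯x_r} → 0`.
For homogeneous `xᵢ` and graded `M` this is a complex of graded modules with differentials of
degree zero, which yields the grading of the local cohomology modules. -/

namespace Cech

section Module

variable {R : Type*} [CommRing R] {r : ℕ} (x : Fin r → R)

/-- The multiplicative set generated by the `xᵢ`, `i ∈ I`; inverting it amounts to inverting
`∏ i ∈ I, xᵢ`. -/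
def denom (I : Finset (Fin r)) : Submonoid R :=
  Submonoid.closure (x '' (I : Set (Fin r)))

lemma denom_mono {I J : Finset (Fin r)} (h : I ⊆ J) : denom x I ≤ denom x J :=
  Submonoid.closure_mono (Set.image_mono (Finset.coe_subset.mpr h))

variable (M : Type*) [AddCommGroup M] [Module R M]

/-- The total Čech module `∏_I M_{x_I}`, over all sets `I` of indices. -/
abbrev Total : Type _ :=
  (I : Finset (Fin r)) → LocalizedModule (denom x I) M

/-- The localization map `M_{x_I} → M_{x_J}` for `I ⊆ J`. -/
def res {I J : Finset (Fin r)} (h : I ⊆ J) :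
    LocalizedModule (denom x I) M →ₗ[R] LocalizedModule (denom x J) M :=
  LocalizedModule.liftOfLE (denom x I) (denom x J) (denom_mono x h)

/-- The sign `(-1)^k`, where `j` is the `k`-th element (counted from `0`) of `J`. -/
def sign (R : Type*) [CommRing R] {r : ℕ} (J : Finset (Fin r)) (j : Fin r) : R :=
  (-1) ^ (J.filter (· < j)).card

/-- The Čech differential `(d c)_J = ∑_{j ∈ J} ± c_{J ∖ {j}}|_J`. -/
def d : Total x M →ₗ[R] Total x M :=
  LinearMap.pi fun J ↦ ∑ j ∈ J, sign R J j •
    (res x M (J.erase_subset j)).comp (LinearMap.proj (J.erase j))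

/-- The Čech cochains of degree `p`: those supported on the index sets with `p` elements. -/
def cochains (p : ℕ) : Submodule R (Total x M) where
  carrier := {c | ∀ I, I.card ≠ p → c I = 0}
  zero_mem' := fun _ _ ↦ rfl
  add_mem' := fun ha hb I hI ↦ by simp [ha I hI, hb I hI]
  smul_mem' := fun t a ha I hI ↦ by simp [ha I hI]

/-- The Čech cocycles of degree `p`. -/
def cocycles (p : ℕ) : Submodule R (Total x M) :=
  cochains x M p ⊓ LinearMap.ker (d x M)

/-- The Čech coboundaries of degree `p`; there are none but `0` in degree `0`. -/
def coboundaries : ℕ → Submodule R (Total x M)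
  | 0 => ⊥
  | p + 1 => (cochains x M p).map (d x M)

lemma res_res {I J K : Finset (Fin r)} (h : I ⊆ J) (h' : J ⊆ K)
    (z : LocalizedModule (denom x I) M) :
    res x M h' (res x M h z) = res x M (h.trans h') z := by
  induction z using LocalizedModule.induction_on with
  | _ m s =>
    simp only [res, IsLocalizedModule.mk_eq_mk', IsLocalizedModule.liftOfLE_mk']

lemma sign_mul_sign {J : Finset (Fin r)} {j k : Fin r} (hj : j ∈ J) (h : j < k) :
    sign R J j * sign R (J.erase j) k + sign R J k * sign R (J.erase k) j = 0 := by
  have h₁ : (J.erase k).filter (· < j) = J.filter (· < j) := by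
    ext i; simp only [Finset.mem_filter, Finset.mem_erase]; grind
  have h₂ : J.filter (· < k) = insert j ((J.erase j).filter (· < k)) := by
    ext i; simp only [Finset.mem_filter, Finset.mem_erase, Finset.mem_insert]; grind
  rw [sign, sign, sign, sign, h₁, h₂, Finset.card_insert_of_notMem (by simp), pow_succ]
  ring

lemma d_d (c : Total x M) : d x M (d x M c) = 0 := by
  funext J
  have hd : ∀ (c : Total x M) (J : Finset (Fin r)), d x M c J =
      ∑ j ∈ J, sign R J j • res x M (J.erase_subset j) (c (J.erase j)) := by
    intro c J
    simp [d]
  have hc : ∀ {I I' : Finset (Fin r)} (e : I = I') (h : I ⊆ J) (h' : I' ⊆ J),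
      res x M h (c I) = res x M h' (c I') := by
    rintro I _ rfl _ _
    rfl
  rw [hd]
  simp only [hd, map_sum, map_smul, res_res, Finset.smul_sum, smul_smul]
  rw [Finset.sum_sigma']
  refine Finset.sum_involution (fun a _ ↦ ⟨a.2, a.1⟩) ?_ ?_ ?_ ?_
  · rintro ⟨j, k⟩ h
    simp only [Finset.mem_sigma, Finset.mem_erase] at h
    obtain ⟨hj, hkj, hk⟩ := h
    rw [hc (Finset.erase_right_comm (a := k) (b := j)) _
      ((Finset.erase_subset _ _).trans (Finset.erase_subset _ _)), ← add_smul]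
    rcases lt_or_gt_of_ne hkj with h | h
    · rw [add_comm, sign_mul_sign hk h, zero_smul]
    · rw [sign_mul_sign hj h, zero_smul]
  · rintro ⟨j, k⟩ h _ e
    simp only [Finset.mem_sigma, Finset.mem_erase] at h
    exact h.2.1 (congrArg Sigma.fst e)
  · rintro ⟨j, k⟩ h
    simp only [Finset.mem_sigma, Finset.mem_erase] at h ⊢
    exact ⟨h.2.2, fun e ↦ h.2.1 e.symm, h.1⟩
  · rintro ⟨j, k⟩ _
    rfl

/-- The `p`-th local cohomology module of `M` with support in the ideal generated by the `xᵢ`. -/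
abbrev H (p : ℕ) : Type _ :=
  cocycles x M p ⧸ (coboundaries x M p).submoduleOf (cocycles x M p)

end Module

section Graded

variable {R : Type*} [CommRing R] {r : ℕ} (x : Fin r → R)
  {M : Type*} [AddCommGroup M] [Module R M]
  (𝒜 : ℕ → AddSubgroup R) [GradedRing 𝒜] (ℳ : ℤ → AddSubgroup M) [GradedAction 𝒜 ℳ]

/-- The component of degree `n` of a homogeneous localization `S⁻¹M`: the fractions `m / s` with
`s ∈ S` homogeneous of degree `e` and `m` homogeneous of degree `e + n`. -/
def locComponent (S : Submonoid R) (n : ℤ) : AddSubgroup (LocalizedModule S M) where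
  carrier := {z | ∃ (e : ℕ) (m : M) (s : S), (s : R) ∈ 𝒜 e ∧ m ∈ ℳ ((e : ℤ) + n) ∧
    z = LocalizedModule.mk m s}
  zero_mem' := ⟨0, 0, 1, SetLike.GradedOne.one_mem, zero_mem _, (LocalizedModule.zero_mk 1).symm⟩
  add_mem' := by
    rintro _ _ ⟨e, m, s, hs, hm, rfl⟩ ⟨e', m', s', hs', hm', rfl⟩
    refine ⟨e + e', s' • m + s • m', s * s', SetLike.GradedMul.mul_mem hs hs',
      add_mem ?_ ?_, LocalizedModule.mk_add_mk⟩
    · have h := GradedAction.smul_mem (ℳ := ℳ) hs' hm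
      rwa [show (e' : ℤ) + (e + n) = ((e + e' : ℕ) : ℤ) + n by push_cast; ring] at h
    · have h := GradedAction.smul_mem (ℳ := ℳ) hs hm'
      rwa [show (e : ℤ) + (e' + n) = ((e + e' : ℕ) : ℤ) + n by push_cast; ring] at h
  neg_mem' := by
    rintro _ ⟨e, m, s, hs, hm, rfl⟩
    exact ⟨e, -m, s, hs, neg_mem hm, LocalizedModule.mk_neg.symm⟩

/-- The component of degree `n` of the total Čech module. -/
def totalComponent (n : ℤ) : AddSubgroup (Total x M) :=
  AddSubgroup.pi Set.univ fun I ↦ locComponent 𝒜 ℳ (denom x I) n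

/-- The component of degree `n` of the `p`-th local cohomology module: the classes of the
cocycles that are homogeneous of degree `n`. -/
def component (p : ℕ) (n : ℤ) : AddSubgroup (H x M p) :=
  ((totalComponent x 𝒜 ℳ n).comap (cocycles x M p).subtype.toAddMonoidHom).map
    ((coboundaries x M p).submoduleOf (cocycles x M p)).mkQ.toAddMonoidHom

end Graded

/-- The finiteness dimension `f^{R₊}_𝔞(M)` of `M` relative to `R₊`, for `𝔞` generated by the `xᵢ`:
the least `i` such that `R₊` is not contained in the radical of the annihilator of `H^i_𝔞(M)`,
and `∞` if there is no such `i`. -/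
def relFinitenessDim {R : Type*} [CommRing R] {r : ℕ} (x : Fin r → R)
    (M : Type*) [AddCommGroup M] [Module R M] (𝒜 : ℕ → AddSubgroup R) [GradedRing 𝒜] : ℕ∞ :=
  ⨅ i ∈ {i : ℕ | ¬ (HomogeneousIdeal.irrelevant 𝒜).toIdeal ≤
    (Module.annihilator R (H x M i)).radical}, (i : ℕ∞)

end Cech

end

/-! ### Gradings of abelian groups and modules -/

section Gradings

variable {M N : Type*} [AddCommGroup M] [AddCommGroup N]

/-! Write H^p(M)_n for the graded pieces of Čech cohomology. They vanish for n ≫ 0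
(`Cech.eventually_atTop_vanishesAt`), so everything is decided as n → -∞. If H^p(M)_n also vanishes
for n ≪ 0, only finitely many degrees survive, and a power of each degree-one generator of R₊ kills
H^p(M).

Let f be the least level at which vanishing for n ≪ 0 fails. The key is
`Cech.eventually_atBot_mem_homogCoboundaries_of_smul_mem`: in very low degrees no non-zero class of
H^f(M) is annihilated by all the generators. Such a class can therefore be multiplied by generators,
one degree at a time, and stay non-zero up to a fixed degree. As non-zero classes occur in
arbitrarily low degrees, every sufficiently low degree is non-zero and no power of R₊ kills H^f(M).
Hence both infima equal f.

The key lemma is an induction on the level, for all finitely generated graded modules at once. Let φ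
: M → M(1)^ι be multiplication by the generators, with kernel T and cokernel C. Since R₊ kills T,
this module has finitely many degrees, and its cohomology vanishes for n ≪ 0 at every level. So for
n ≪ 0 the classes of H^{g+1}(M)_n killed by all generators are governed by H^g(C)_n. Conversely, the
connecting map embeds H^g(C)_n into these classes, so H^g(C)_n is itself killed by the generators
and is zero by induction applied to C.

The long exact sequences are used elementwise on homogeneous cochains, so no category of graded
modules is needed. -/

lemma isInternal_of_forall_sum (ℳ : ℤ → AddSubgroup M)
    (indep : ∀ (F : Finset ℤ) (f : ℤ → M), (∀ n, f n ∈ ℳ n) → ∑ n ∈ F, f n = 0 →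
      ∀ n ∈ F, f n = 0)
    (span : ∀ m, ∃ (F : Finset ℤ) (f : ℤ → M), (∀ n, f n ∈ ℳ n) ∧ ∑ n ∈ F, f n = m) :
    DirectSum.IsInternal ℳ := by
  classical
  constructor
  · rw [injective_iff_map_eq_zero]
    intro a ha
    rw [DirectSum.coeAddMonoidHom_eq_dfinsuppSum, DFinsupp.sum] at ha
    ext n
    by_cases hn : n ∈ DFinsupp.support a
    · simpa using indep _ (fun n ↦ (a n : M)) (fun n ↦ (a n).2) ha n hn
    · simpa using hn
  · intro m
    obtain ⟨F, f, hf, rfl⟩ := span m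
    refine ⟨∑ n ∈ F, DirectSum.of (fun n ↦ ℳ n) n ⟨f n, hf n⟩, ?_⟩
    simp [map_sum]

section Component

variable (ℳ : ℤ → AddSubgroup M) [DirectSum.Decomposition ℳ]
  (𝒩 : ℤ → AddSubgroup N) [DirectSum.Decomposition 𝒩]

/-- The projection of a graded group to its component of degree `n`. -/
noncomputable def homogComponent (n : ℤ) : M →+ M where
  toFun m := (DirectSum.decompose ℳ m n : M)
  map_zero' := by simp
  map_add' a b := by simp

lemma homogComponent_mem (n : ℤ) (m : M) : homogComponent ℳ n m ∈ ℳ n :=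
  (DirectSum.decompose ℳ m n).2

variable {ℳ} in
lemma homogComponent_of_mem {n : ℤ} {m : M} (h : m ∈ ℳ n) : homogComponent ℳ n m = m :=
  DirectSum.decompose_of_mem_same ℳ h

variable {ℳ} in
lemma homogComponent_of_mem_ne {n k : ℤ} {m : M} (h : m ∈ ℳ n) (hk : n ≠ k) :
    homogComponent ℳ k m = 0 :=
  DirectSum.decompose_of_mem_ne ℳ h hk

lemma exists_sum_homogComponent (m : M) :
    ∃ F : Finset ℤ, (∀ n ∉ F, homogComponent ℳ n m = 0) ∧
      ∑ n ∈ F, homogComponent ℳ n m = m := by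
  classical
  refine ⟨DFinsupp.support (DirectSum.decompose ℳ m), fun n hn ↦ ?_,
    DirectSum.sum_support_decompose ℳ m⟩
  simpa [homogComponent] using hn

lemma homogComponent_sum_of_mem {F : Finset ℤ} {f : ℤ → M} (hf : ∀ n, f n ∈ ℳ n) {k : ℤ}
    (hk : k ∈ F) : homogComponent ℳ k (∑ n ∈ F, f n) = f k := by
  rw [map_sum, Finset.sum_eq_single k, homogComponent_of_mem (hf k)]
  · exact fun n _ hn ↦ homogComponent_of_mem_ne (hf n) hn
  · exact fun h ↦ absurd hk h

lemma map_homogComponent_add (φ : M →+ N) (a : ℤ) (h : ∀ n, ∀ m ∈ ℳ n, φ m ∈ 𝒩 (a + n)) (n : ℤ)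
    (m : M) : φ (homogComponent ℳ n m) = homogComponent 𝒩 (a + n) (φ m) := by
  induction m using DirectSum.Decomposition.inductionOn ℳ with
  | zero => simp
  | @homogeneous i m =>
    by_cases hi : i = n
    · subst hi
      rw [homogComponent_of_mem m.2, homogComponent_of_mem (h _ _ m.2)]
    · rw [homogComponent_of_mem_ne m.2 hi, homogComponent_of_mem_ne (h _ _ m.2) (by simpa), map_zero]
  | add a b ha hb => simp [ha, hb]

lemma map_homogComponent (φ : M →+ N) (h : ∀ n, ∀ m ∈ ℳ n, φ m ∈ 𝒩 n) (n : ℤ)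
    (m : M) : φ (homogComponent ℳ n m) = homogComponent 𝒩 n (φ m) := by
  simpa using map_homogComponent_add ℳ 𝒩 φ 0 (by simpa using h) n m

end Component

end Gradings

/-! ### Induced gradings on submodules, quotients and shifted powers. -/

section GradedModules

variable {R : Type*} [CommRing R] (𝒜 : ℕ → AddSubgroup R)
  {M N : Type*} [AddCommGroup M] [AddCommGroup N] [Module R M] [Module R N]
  (ℳ : ℤ → AddSubgroup M) (𝒩 : ℤ → AddSubgroup N)

lemma homogComponent_smul [GradedAction 𝒜 ℳ] [DirectSum.Decomposition ℳ] {i : ℕ} {r : R}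
    (hr : r ∈ 𝒜 i) (n : ℤ) (m : M) :
    homogComponent ℳ (i + n) (r • m) = r • homogComponent ℳ n m :=
  (map_homogComponent_add ℳ ℳ (DistribSMul.toAddMonoidHom M r) i
    (fun _ _ hm ↦ GradedAction.smul_mem hr hm) n m).symm

/-- The grading induced on a submodule. -/
def subGrading (P : Submodule R M) (n : ℤ) : AddSubgroup P :=
  (ℳ n).comap P.subtype.toAddMonoidHom

/-- The grading induced on a quotient module. -/
def quotGrading (P : Submodule R M) (n : ℤ) : AddSubgroup (M ⧸ P) :=
  (ℳ n).map P.mkQ.toAddMonoidHom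

/-- The grading of `∏ M(1)`. -/
def piShiftGrading (ι : Type*) (n : ℤ) : AddSubgroup (ι → M) :=
  AddSubgroup.pi Set.univ fun _ ↦ ℳ (n + 1)

variable {ℳ} in
lemma mem_piShiftGrading {ι : Type*} {n : ℤ} {f : ι → M} :
    f ∈ piShiftGrading ℳ ι n ↔ ∀ k, f k ∈ ℳ (n + 1) := by
  simp [piShiftGrading, AddSubgroup.mem_pi]

instance [GradedAction 𝒜 ℳ] (P : Submodule R M) : GradedAction 𝒜 (subGrading ℳ P) where
  smul_mem hr hm := GradedAction.smul_mem (ℳ := ℳ) hr hm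

instance [GradedAction 𝒜 ℳ] (P : Submodule R M) : GradedAction 𝒜 (quotGrading ℳ P) where
  smul_mem := by
    rintro i n r _ hr ⟨m, hm, rfl⟩
    exact ⟨r • m, GradedAction.smul_mem hr hm, map_smul P.mkQ r m⟩

instance [GradedAction 𝒜 ℳ] (ι : Type*) : GradedAction 𝒜 (piShiftGrading ℳ ι) where
  smul_mem hr hm := mem_piShiftGrading.2 fun k ↦ by
    rw [add_assoc]
    exact GradedAction.smul_mem hr (mem_piShiftGrading.1 hm k)

variable [DirectSum.Decomposition ℳ] [DirectSum.Decomposition 𝒩]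

lemma isInternal_subGrading (P : Submodule R M) (hP : ∀ n, ∀ m ∈ P, homogComponent ℳ n m ∈ P) :
    DirectSum.IsInternal (subGrading ℳ P) := by
  refine isInternal_of_forall_sum _ (fun F f hf h n hn ↦ ?_) fun m ↦ ?_
  · have := homogComponent_sum_of_mem ℳ (f := fun n ↦ (f n : M)) hf hn
    rw [← AddSubmonoidClass.coe_finsetSum, h] at this
    exact Subtype.ext (by simpa using this.symm)
  · obtain ⟨F, -, hF⟩ := exists_sum_homogComponent ℳ (m : M)
    exact ⟨F, fun n ↦ ⟨homogComponent ℳ n m, hP n m m.2⟩,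
      fun n ↦ homogComponent_mem ℳ n _, Subtype.ext (by simpa using hF)⟩

lemma isInternal_quotGrading (P : Submodule R M) (hP : ∀ n, ∀ m ∈ P, homogComponent ℳ n m ∈ P) :
    DirectSum.IsInternal (quotGrading ℳ P) := by
  refine isInternal_of_forall_sum _ (fun F f hf h n hn ↦ ?_) fun m ↦ ?_
  · choose g hg hgf using hf
    have hgf' : ∀ n, P.mkQ (g n) = f n := hgf
    simp only [← hgf', ← map_sum] at h ⊢
    rw [Submodule.mkQ_apply, Submodule.Quotient.mk_eq_zero] at h ⊢
    simpa [homogComponent_sum_of_mem ℳ hg hn] using hP n _ h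
  · obtain ⟨m, rfl⟩ := P.mkQ_surjective m
    obtain ⟨F, -, hF⟩ := exists_sum_homogComponent ℳ (m : M)
    exact ⟨F, fun n ↦ P.mkQ (homogComponent ℳ n m),
      fun n ↦ ⟨_, homogComponent_mem ℳ n m, rfl⟩, by rw [← map_sum, hF]⟩

lemma isInternal_piShiftGrading (ι : Type*) [Finite ι] :
    DirectSum.IsInternal (piShiftGrading ℳ ι) := by
  classical
  have := Fintype.ofFinite ι
  refine isInternal_of_forall_sum _ (fun F f hf h n hn ↦ ?_) fun m ↦ ?_
  · funext k
    have := homogComponent_sum_of_mem ℳ (F := F.map (addRightEmbedding 1))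
      (f := fun n ↦ f (n - 1) k) (k := n + 1)
      (fun n ↦ by simpa using mem_piShiftGrading.1 (hf (n - 1)) k) (by simpa using hn)
    rw [Finset.sum_map] at this
    simp only [addRightEmbedding_apply, add_sub_cancel_right] at this
    rw [← this, ← Finset.sum_apply, h]
    simp
  · choose F hF hFs using fun k ↦ exists_sum_homogComponent ℳ (m k)
    -- Degree n of M(1) is degree n + 1 of M, so the supports move down by one.
    let G := (Finset.univ.biUnion F).map (addRightEmbedding (-1))
    refine ⟨G, fun n k ↦ homogComponent ℳ (n + 1) (m k),
      fun n ↦ mem_piShiftGrading.2 fun k ↦ homogComponent_mem _ _ _, ?_⟩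
    funext k
    rw [Finset.sum_apply, Finset.sum_map]
    simp only [addRightEmbedding_apply, neg_add_cancel_right]
    conv_rhs => rw [← hFs k]
    refine (Finset.sum_subset (Finset.subset_biUnion_of_mem F (Finset.mem_univ k)) ?_).symm
    exact fun n _ hn ↦ hF k n hn

variable {ℳ 𝒩}

lemma homogComponent_mem_ker {φ : M →ₗ[R] N} (hφ : ∀ n, ∀ m ∈ ℳ n, φ m ∈ 𝒩 n) (n : ℤ)
    (m : M) (hm : m ∈ LinearMap.ker φ) : homogComponent ℳ n m ∈ LinearMap.ker φ := by
  have := map_homogComponent ℳ 𝒩 φ.toAddMonoidHom hφ n m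
  simp_all

lemma homogComponent_mem_range {φ : M →ₗ[R] N} (hφ : ∀ n, ∀ m ∈ ℳ n, φ m ∈ 𝒩 n) (n : ℤ)
    (m : N) (hm : m ∈ LinearMap.range φ) : homogComponent 𝒩 n m ∈ LinearMap.range φ := by
  obtain ⟨a, rfl⟩ := hm
  exact ⟨_, map_homogComponent ℳ 𝒩 φ.toAddMonoidHom hφ n a⟩

end GradedModules

namespace Cech

/-! ### Homogeneous localizations. -/

section Localization

variable {R : Type*} [CommRing R] {S : Submonoid R} {M : Type*} [AddCommGroup M] [Module R M]

lemma mk_eq_zero_iff {m : M} {s : S} :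
    LocalizedModule.mk m s = 0 ↔ ∃ u : S, u • m = 0 := by
  rw [← LocalizedModule.zero_mk 1, LocalizedModule.mk_eq]
  simp

lemma exists_eq_mk (z : LocalizedModule S M) : ∃ m s, z = LocalizedModule.mk m s :=
  LocalizedModule.induction_on (fun m s ↦ ⟨m, s, rfl⟩) z

lemma mk_sum {ι : Type*} (F : Finset ι) (f : ι → M) (s : S) :
    LocalizedModule.mk (∑ k ∈ F, f k) s = ∑ k ∈ F, LocalizedModule.mk (f k) s := by
  classical
  induction F using Finset.induction_on with
  | empty => simp
  | insert k F hk ih =>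
    rw [Finset.sum_insert hk, Finset.sum_insert hk, ← ih]
    simp only [IsLocalizedModule.mk_eq_mk', IsLocalizedModule.mk'_add]

variable (𝒜 : ℕ → AddSubgroup R) [GradedRing 𝒜] (ℳ : ℤ → AddSubgroup M) [GradedAction 𝒜 ℳ]

lemma smul_mem_locComponent {i : ℕ} {r : R} (hr : r ∈ 𝒜 i) {n : ℤ} {z : LocalizedModule S M}
    (hz : z ∈ locComponent 𝒜 ℳ S n) : r • z ∈ locComponent 𝒜 ℳ S (i + n) := by
  obtain ⟨e, m, s, hs, hm, rfl⟩ := hz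
  refine ⟨e, r • m, s, hs, ?_, LocalizedModule.smul'_mk r m s⟩
  rw [add_left_comm]
  exact GradedAction.smul_mem hr hm

/-- With one homogeneous denominator, a relation between fractions of different degrees becomes,
after clearing it, a relation between numerators in distinct components of M. -/
lemma exists_common_denom (F : Finset ℤ) (f : ℤ → LocalizedModule S M)
    (hf : ∀ n, f n ∈ locComponent 𝒜 ℳ S n) :
    ∃ (e : ℕ) (s : S), (s : R) ∈ 𝒜 e ∧ ∀ n ∈ F, ∃ m ∈ ℳ (e + n), f n = LocalizedModule.mk m s := by
  induction F using Finset.induction_on with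
  | empty => exact ⟨0, 1, SetLike.GradedOne.one_mem, by simp⟩
  | insert k F _ ih =>
    obtain ⟨e, s, hs, h⟩ := ih
    obtain ⟨e', m, t, ht, hm, hk⟩ := hf k
    refine ⟨e + e', s * t, SetLike.GradedMul.mul_mem hs ht, fun n hn ↦ ?_⟩
    rcases Finset.mem_insert.1 hn with rfl | hn
    · refine ⟨s • m, ?_, by rw [hk, LocalizedModule.mk_cancel_common_left]⟩
      have := GradedAction.smul_mem (ℳ := ℳ) hs hm
      push_cast
      rwa [add_assoc]
    · obtain ⟨m', hm', h'⟩ := h n hn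
      refine ⟨t • m', ?_, by rw [h', LocalizedModule.mk_cancel_common_right]⟩
      have := GradedAction.smul_mem (ℳ := ℳ) ht hm'
      push_cast
      rwa [add_right_comm, add_comm]

lemma isInternal_locComponent [DirectSum.Decomposition ℳ]
    (hS : ∀ s ∈ S, SetLike.IsHomogeneousElem 𝒜 s) :
    DirectSum.IsInternal (locComponent 𝒜 ℳ S) := by
  refine isInternal_of_forall_sum _ (fun F f hf h k hk ↦ ?_) fun z ↦ ?_
  · obtain ⟨e, s, hs, hm⟩ := exists_common_denom 𝒜 ℳ F f hf
    choose! m hm hfm using hm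
    have hsum : ∑ n ∈ F, f n = LocalizedModule.mk (∑ n ∈ F, m n) s := by
      rw [Finset.sum_congr rfl hfm, mk_sum]
    rw [hsum, mk_eq_zero_iff] at h
    obtain ⟨u, hu⟩ := h
    obtain ⟨d, hd⟩ := hS u u.2
    rw [hfm k hk, mk_eq_zero_iff]
    refine ⟨u, ?_⟩
    -- As u is homogeneous of degree d, the component of u • ∑ m n = 0 in degree d + e + k is u • m
    -- k.
    have h0 := homogComponent_smul 𝒜 ℳ hd (e + k) (∑ n ∈ F, m n)
    have hu' : (u : R) • ∑ n ∈ F, m n = 0 := hu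
    rw [hu', map_zero, map_sum, Finset.sum_eq_single k] at h0
    · rw [homogComponent_of_mem (hm k hk)] at h0
      exact h0.symm
    · exact fun n hn hne ↦ homogComponent_of_mem_ne (hm n hn) (by simpa using hne)
    · exact fun h ↦ absurd hk h
  · induction z using LocalizedModule.induction_on with
    | _ m s =>
      obtain ⟨e, he⟩ := hS s s.2
      obtain ⟨F, -, hF⟩ := exists_sum_homogComponent ℳ m
      refine ⟨F.map (addRightEmbedding (-(e : ℤ))),
        fun n ↦ LocalizedModule.mk (homogComponent ℳ (e + n) m) s,
        fun n ↦ ⟨e, _, s, he, homogComponent_mem ℳ _ m, rfl⟩, ?_⟩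
      rw [Finset.sum_map]
      conv_rhs => rw [← hF, mk_sum]
      simp

end Localization

/-! ### Functoriality of the Čech complex in the module. -/

section Total

variable {R : Type*} [CommRing R] {r : ℕ} (x : Fin r → R)
  {M N P : Type*} [AddCommGroup M] [Module R M] [AddCommGroup N] [Module R N]
  [AddCommGroup P] [Module R P]

lemma d_apply (c : Total x M) (J : Finset (Fin r)) : d x M c J =
    ∑ j ∈ J, sign R J j • res x M (J.erase_subset j) (c (J.erase j)) := by
  simp [d]

lemma res_mk {I J : Finset (Fin r)} (h : I ⊆ J) (m : M) (s : denom x I) :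
    res x M h (LocalizedModule.mk m s) = LocalizedModule.mk m (⟨(s : R), denom_mono x h s.2⟩ : denom x J) := by
  simp only [IsLocalizedModule.mk_eq_mk', IsLocalizedModule.liftOfLE_mk', res]

/-- The map of total Čech modules induced by a linear map. -/
noncomputable def map (φ : M →ₗ[R] N) : Total x M →ₗ[R] Total x N :=
  LinearMap.pi fun I ↦ (IsLocalizedModule.map (denom x I)
    (LocalizedModule.mkLinearMap (denom x I) M) (LocalizedModule.mkLinearMap (denom x I) N) φ).comp
      (LinearMap.proj I)

lemma map_apply_of_eq_mk (φ : M →ₗ[R] N) {c : Total x M} {I : Finset (Fin r)} {m : M}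
    {s : denom x I} (h : c I = LocalizedModule.mk m s) :
    map x φ c I = LocalizedModule.mk (φ m) s := by
  simp only [map, LinearMap.pi_apply, LinearMap.comp_apply, LinearMap.proj_apply, h]
  simp only [IsLocalizedModule.mk_eq_mk', IsLocalizedModule.map_mk']

lemma map_apply_eq_zero (φ : M →ₗ[R] N) {c : Total x M} {I : Finset (Fin r)} (h : c I = 0) :
    map x φ c I = 0 := by
  simp [map, h]

lemma map_map (φ : M →ₗ[R] N) (ψ : N →ₗ[R] P) (c : Total x M) :
    map x ψ (map x φ c) = map x (ψ ∘ₗ φ) c := by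
  funext I
  obtain ⟨m, s, h⟩ := exists_eq_mk (c I)
  rw [map_apply_of_eq_mk x _ h, map_apply_of_eq_mk x _ (map_apply_of_eq_mk x _ h)]
  rfl

lemma map_smul_id (a : R) (c : Total x M) : map x (a • LinearMap.id) c = a • c := by
  funext I
  obtain ⟨m, s, h⟩ := exists_eq_mk (c I)
  rw [map_apply_of_eq_mk x _ h, Pi.smul_apply, h, LocalizedModule.smul'_mk]
  rfl

lemma map_id (c : Total x M) : map x LinearMap.id c = c := by
  simpa using map_smul_id x (1 : R) c

lemma map_sum_left {ι : Type*} (F : Finset ι) (φ : ι → M →ₗ[R] N) (c : Total x M) :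
    map x (∑ k ∈ F, φ k) c = ∑ k ∈ F, map x (φ k) c := by
  funext I
  simp [map]

lemma map_zero_left (c : Total x M) : map x (0 : M →ₗ[R] N) c = 0 := by
  funext I
  simp [map]

lemma map_d (φ : M →ₗ[R] N) (c : Total x M) : map x φ (d x M c) = d x N (map x φ c) := by
  funext J
  have hres : ∀ j, IsLocalizedModule.map (denom x J) (LocalizedModule.mkLinearMap (denom x J) M)
      (LocalizedModule.mkLinearMap (denom x J) N) φ (res x M (J.erase_subset j) (c (J.erase j))) =
      res x N (J.erase_subset j) (map x φ c (J.erase j)) := by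
    intro j
    obtain ⟨m, s, h⟩ := exists_eq_mk (c (J.erase j))
    rw [map_apply_of_eq_mk x _ h, h, res_mk, res_mk]
    simp only [IsLocalizedModule.mk_eq_mk', IsLocalizedModule.map_mk']
  rw [d_apply, ← Finset.sum_congr rfl fun j _ ↦ congrArg (sign R J j • ·) (hres j)]
  simp only [map, LinearMap.pi_apply, LinearMap.comp_apply, LinearMap.proj_apply, d_apply, map_sum,
    map_smul]

lemma map_injective {φ : M →ₗ[R] N} (h : Function.Injective φ) :
    Function.Injective (map x φ) := fun _ _ hab ↦ funext fun I ↦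
  IsLocalizedModule.map_injective (denom x I) _ _ φ h (congrFun hab I)

lemma map_mem_cochains (φ : M →ₗ[R] N) {p : ℕ} {c : Total x M} (hc : c ∈ cochains x M p) :
    map x φ c ∈ cochains x N p := fun I hI ↦ map_apply_eq_zero x φ (hc I hI)

lemma d_mem_cochains {p : ℕ} {c : Total x M} (hc : c ∈ cochains x M p) :
    d x M c ∈ cochains x M (p + 1) := fun J hJ ↦ by
  rw [d_apply]
  refine Finset.sum_eq_zero fun j hj ↦ ?_
  rw [hc, map_zero, smul_zero]
  have := Finset.card_erase_add_one hj
  omega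

end Total

/-! ### The subcomplex of homogeneous cochains of a given degree. -/

section Homogeneous

variable {R : Type*} [CommRing R] {r : ℕ} (x : Fin r → R)
  (𝒜 : ℕ → AddSubgroup R) [GradedRing 𝒜]
  {M N : Type*} [AddCommGroup M] [Module R M] [AddCommGroup N] [Module R N]
  (ℳ : ℤ → AddSubgroup M) [GradedAction 𝒜 ℳ] (𝒩 : ℤ → AddSubgroup N) [GradedAction 𝒜 𝒩]

lemma mem_totalComponent {n : ℤ} {c : Total x M} :
    c ∈ totalComponent x 𝒜 ℳ n ↔ ∀ I, c I ∈ locComponent 𝒜 ℳ (denom x I) n := by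
  simp [totalComponent, AddSubgroup.mem_pi]

include 𝒜 in
lemma isHomogeneousElem_of_mem_denom (hx : ∀ i, SetLike.IsHomogeneousElem 𝒜 (x i))
    {I : Finset (Fin r)} {s : R} (hs : s ∈ denom x I) : SetLike.IsHomogeneousElem 𝒜 s := by
  induction hs using Submonoid.closure_induction with
  | mem s hs =>
    obtain ⟨i, -, rfl⟩ := hs
    exact hx i
  | one => exact SetLike.isHomogeneousElem_one 𝒜
  | mul a b _ _ ha hb => exact ha.mul hb

lemma smul_mem_totalComponent {i : ℕ} {a : R} (ha : a ∈ 𝒜 i) {n : ℤ} {c : Total x M}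
    (hc : c ∈ totalComponent x 𝒜 ℳ n) : a • c ∈ totalComponent x 𝒜 ℳ (i + n) := by
  rw [mem_totalComponent] at hc ⊢
  exact fun I ↦ smul_mem_locComponent 𝒜 ℳ ha (hc I)

lemma d_mem_totalComponent {n : ℤ} {c : Total x M} (hc : c ∈ totalComponent x 𝒜 ℳ n) :
    d x M c ∈ totalComponent x 𝒜 ℳ n := by
  rw [mem_totalComponent] at hc ⊢
  intro J
  rw [d_apply]
  refine sum_mem fun j _ ↦ ?_
  obtain ⟨e, m, s, hs, hm, h⟩ := hc (J.erase j)
  have hmem : res x M (J.erase_subset j) (c (J.erase j)) ∈ locComponent 𝒜 ℳ (denom x J) n :=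
    ⟨e, m, ⟨s, denom_mono x (J.erase_subset j) s.2⟩, hs, hm, by rw [h, res_mk]⟩
  rcases neg_one_pow_eq_or R (J.filter (· < j)).card with h | h
  · simpa [sign, h] using hmem
  · simpa [sign, h] using hmem

/-- The two degrees n and n' are kept independent, so that the lemma also covers projections and
inclusions of factors of M(1)^ι. -/
lemma map_mem_totalComponent (φ : M →ₗ[R] N) {n n' : ℤ}
    (hφ : ∀ e : ℕ, ∀ m ∈ ℳ (e + n), φ m ∈ 𝒩 (e + n')) {c : Total x M}
    (hc : c ∈ totalComponent x 𝒜 ℳ n) : map x φ c ∈ totalComponent x 𝒜 𝒩 n' := by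
  rw [mem_totalComponent] at hc ⊢
  intro I
  obtain ⟨e, m, s, hs, hm, h⟩ := hc I
  exact ⟨e, φ m, s, hs, hφ e m hm, map_apply_of_eq_mk x φ h⟩

/-- Homogeneous Čech cochains of degree `n`, indexed so that those of cohomological degree `p`
stand at `p + 1`, with `0` below. -/
noncomputable def homogCochains (n : ℤ) : ℕ → AddSubgroup (Total x M)
  | 0 => ⊥
  | p + 1 => (cochains x M p).toAddSubgroup ⊓ totalComponent x 𝒜 ℳ n

/-- The Čech `p`-cocycles that are homogeneous of degree `n`. -/
noncomputable def homogCocycles (p : ℕ) (n : ℤ) : AddSubgroup (Total x M) :=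
  homogCochains x 𝒜 ℳ n (p + 1) ⊓ (d x M).toAddMonoidHom.ker

/-- The coboundaries of homogeneous Čech `(p-1)`-cochains of degree `n`. -/
noncomputable def homogCoboundaries (p : ℕ) (n : ℤ) : AddSubgroup (Total x M) :=
  (homogCochains x 𝒜 ℳ n p).map (d x M).toAddMonoidHom

/-- The vanishing of the component of degree `n` of the `p`-th Čech cohomology. -/
def VanishesAt (p : ℕ) (n : ℤ) : Prop :=
  homogCocycles x 𝒜 ℳ p n ≤ homogCoboundaries x 𝒜 ℳ p n

variable {x 𝒜 ℳ 𝒩}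

lemma mem_homogCocycles {n : ℤ} {p : ℕ} {c : Total x M} :
    c ∈ homogCocycles x 𝒜 ℳ p n ↔ c ∈ homogCochains x 𝒜 ℳ n (p + 1) ∧ d x M c = 0 := Iff.rfl

lemma mem_homogCoboundaries {n : ℤ} {p : ℕ} {c : Total x M} :
    c ∈ homogCoboundaries x 𝒜 ℳ p n ↔ ∃ b ∈ homogCochains x 𝒜 ℳ n p, d x M b = c := Iff.rfl

lemma d_mem_homogCochains {n : ℤ} {p : ℕ} {c : Total x M} (hc : c ∈ homogCochains x 𝒜 ℳ n p) :
    d x M c ∈ homogCochains x 𝒜 ℳ n (p + 1) := by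
  cases p with
  | zero => rw [AddSubgroup.mem_bot.1 hc, map_zero]; exact zero_mem _
  | succ p => exact ⟨d_mem_cochains x hc.1, d_mem_totalComponent x 𝒜 ℳ hc.2⟩

lemma smul_mem_homogCochains {n : ℤ} {p : ℕ} {c : Total x M} (hc : c ∈ homogCochains x 𝒜 ℳ n p)
    {i : ℕ} {a : R} (ha : a ∈ 𝒜 i) : a • c ∈ homogCochains x 𝒜 ℳ (i + n) p := by
  cases p with
  | zero => rw [AddSubgroup.mem_bot.1 hc, smul_zero]; exact zero_mem _
  | succ p => exact ⟨(cochains x M p).smul_mem a hc.1, smul_mem_totalComponent x 𝒜 ℳ ha hc.2⟩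

lemma smul_mem_homogCocycles {n : ℤ} {p : ℕ} {c : Total x M} (hc : c ∈ homogCocycles x 𝒜 ℳ p n)
    {i : ℕ} {a : R} (ha : a ∈ 𝒜 i) : a • c ∈ homogCocycles x 𝒜 ℳ p (i + n) :=
  ⟨smul_mem_homogCochains hc.1 ha, by
    have : d x M c = 0 := hc.2
    change d x M (a • c) = 0
    rw [map_smul, this, smul_zero]⟩

section Map

variable {φ : M →ₗ[R] N} {n n' : ℤ} (hφ : ∀ e : ℕ, ∀ m ∈ ℳ (e + n), φ m ∈ 𝒩 (e + n')) {p : ℕ}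
  {c : Total x M}
include hφ

lemma map_mem_homogCochains (hc : c ∈ homogCochains x 𝒜 ℳ n p) :
    map x φ c ∈ homogCochains x 𝒜 𝒩 n' p := by
  cases p with
  | zero => rw [AddSubgroup.mem_bot.1 hc, map_zero]; exact zero_mem _
  | succ p => exact ⟨map_mem_cochains x φ hc.1, map_mem_totalComponent x 𝒜 ℳ 𝒩 φ hφ hc.2⟩

lemma map_mem_homogCocycles (hc : c ∈ homogCocycles x 𝒜 ℳ p n) :
    map x φ c ∈ homogCocycles x 𝒜 𝒩 p n' :=
  ⟨map_mem_homogCochains hφ hc.1, by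
    have : d x M c = 0 := hc.2
    change d x N (map x φ c) = 0
    rw [← map_d, this, map_zero]⟩

lemma map_mem_homogCoboundaries (hc : c ∈ homogCoboundaries x 𝒜 ℳ p n) :
    map x φ c ∈ homogCoboundaries x 𝒜 𝒩 p n' := by
  obtain ⟨b, hb, rfl⟩ := hc
  exact ⟨map x φ b, map_mem_homogCochains hφ hb, (map_d x φ b).symm⟩

end Map

end Homogeneous

end Cech

/-- A short exact sequence `0 → L → M → N → 0` of graded modules and maps of degree zero. -/
structure IsGradedShortExact {R L M N : Type*} [CommRing R] [AddCommGroup L] [Module R L]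
    [AddCommGroup M] [Module R M] [AddCommGroup N] [Module R N] (ℒ : ℤ → AddSubgroup L)
    (ℳ : ℤ → AddSubgroup M) (𝒩 : ℤ → AddSubgroup N) (φ : L →ₗ[R] M) (ψ : M →ₗ[R] N) : Prop where
  injective : Function.Injective φ
  map_mem_left : ∀ n, ∀ l ∈ ℒ n, φ l ∈ ℳ n
  map_mem_right : ∀ n, ∀ m ∈ ℳ n, ψ m ∈ 𝒩 n
  comp_eq_zero : ψ ∘ₗ φ = 0
  exists_of_map_eq_zero : ∀ n, ∀ m ∈ ℳ n, ψ m = 0 → ∃ l ∈ ℒ n, φ l = m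
  exists_lift : ∀ n, ∀ a ∈ 𝒩 n, ∃ m ∈ ℳ n, ψ m = a

namespace Cech

/-! ### The long exact cohomology sequence, degree by degree. -/

section LongExactSequence

variable {R : Type*} [CommRing R] {r : ℕ} {x : Fin r → R}
  {𝒜 : ℕ → AddSubgroup R} [GradedRing 𝒜]
  {L M N : Type*} [AddCommGroup L] [Module R L] [AddCommGroup M] [Module R M]
  [AddCommGroup N] [Module R N]
  {ℒ : ℤ → AddSubgroup L} [GradedAction 𝒜 ℒ] {ℳ : ℤ → AddSubgroup M} [GradedAction 𝒜 ℳ]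
  {𝒩 : ℤ → AddSubgroup N} [GradedAction 𝒜 𝒩] {φ : L →ₗ[R] M} {ψ : M →ₗ[R] N}
  (h : IsGradedShortExact ℒ ℳ 𝒩 φ ψ) {n : ℤ} {p : ℕ}
include h

lemma map_map_eq_zero (c : Total x L) : map x ψ (map x φ c) = 0 := by
  rw [map_map, h.comp_eq_zero, map_zero_left]

omit [GradedAction 𝒜 ℒ] in
lemma exists_lift_homogCochains {c : Total x N} (hc : c ∈ homogCochains x 𝒜 𝒩 n p) :
    ∃ b ∈ homogCochains x 𝒜 ℳ n p, map x ψ b = c := by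
  cases p with
  | zero => exact ⟨0, zero_mem _, by rw [map_zero, AddSubgroup.mem_bot.1 hc]⟩
  | succ p =>
    have key : ∀ I, ∃ z ∈ locComponent 𝒜 ℳ (denom x I) n, (I.card ≠ p → z = 0) ∧
        ∀ b : Total x M, b I = z → map x ψ b I = c I := by
      intro I
      by_cases hI : I.card = p
      · obtain ⟨e, a, s, hs, ha, hcI⟩ := (mem_totalComponent x 𝒜 𝒩).1 hc.2 I
        obtain ⟨m, hm, rfl⟩ := h.exists_lift _ a ha
        exact ⟨_, ⟨e, m, s, hs, hm, rfl⟩, fun h ↦ absurd hI h,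
          fun b hb ↦ by rw [map_apply_of_eq_mk x ψ hb, hcI]⟩
      · exact ⟨0, zero_mem _, fun _ ↦ rfl,
          fun b hb ↦ by rw [map_apply_eq_zero x ψ hb, hc.1 I hI]⟩
    choose b hb hb0 hbc using key
    exact ⟨b, ⟨hb0, (mem_totalComponent x 𝒜 ℳ).2 hb⟩, funext fun I ↦ hbc I b rfl⟩

omit [GradedAction 𝒜 𝒩] in
lemma exists_of_map_eq_zero_homogCochains (hx : ∀ i, SetLike.IsHomogeneousElem 𝒜 (x i))
    {c : Total x M} (hc : c ∈ homogCochains x 𝒜 ℳ n p) (hψ : map x ψ c = 0) :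
    ∃ b ∈ homogCochains x 𝒜 ℒ n p, map x φ b = c := by
  cases p with
  | zero => exact ⟨0, zero_mem _, by rw [map_zero, AddSubgroup.mem_bot.1 hc]⟩
  | succ p =>
    have key : ∀ I, ∃ z ∈ locComponent 𝒜 ℒ (denom x I) n, (I.card ≠ p → z = 0) ∧
        ∀ b : Total x L, b I = z → map x φ b I = c I := by
      intro I
      by_cases hI : I.card = p
      · obtain ⟨e, m, s, hs, hm, hcI⟩ := (mem_totalComponent x 𝒜 ℳ).1 hc.2 I
        have h0 := congrFun hψ I
        rw [map_apply_of_eq_mk x ψ hcI, Pi.zero_apply, mk_eq_zero_iff] at h0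
        -- The image ψ m / s is zero only after multiplication by some u, so m / s is rewritten as
        -- (u m) / (u s), where u m does lie in the kernel of ψ. Homogeneity of u keeps the degree.
        obtain ⟨u, hu⟩ := h0
        obtain ⟨k, hk⟩ := isHomogeneousElem_of_mem_denom x 𝒜 hx u.2
        obtain ⟨l, hl, hlm⟩ := h.exists_of_map_eq_zero _ _ (GradedAction.smul_mem hk hm)
          (by rw [map_smul]; exact hu)
        refine ⟨_, ⟨k + e, l, u * s, SetLike.GradedMul.mul_mem hk hs, ?_, rfl⟩,
          fun h ↦ absurd hI h, fun b hb ↦ ?_⟩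
        · push_cast
          rwa [add_assoc]
        · rw [map_apply_of_eq_mk x φ hb, hcI, hlm]
          exact LocalizedModule.mk_cancel_common_left u s m
      · exact ⟨0, zero_mem _, fun _ ↦ rfl,
          fun b hb ↦ by rw [map_apply_eq_zero x φ hb, hc.1 I hI]⟩
    choose b hb hb0 hbc using key
    exact ⟨b, ⟨hb0, (mem_totalComponent x 𝒜 ℒ).2 hb⟩, funext fun I ↦ hbc I b rfl⟩

/-- Exactness at H^p(M)_n. -/
lemma exists_sub_map_mem_homogCoboundaries (hx : ∀ i, SetLike.IsHomogeneousElem 𝒜 (x i))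
    {c : Total x M} (hc : c ∈ homogCocycles x 𝒜 ℳ p n)
    (hψ : map x ψ c ∈ homogCoboundaries x 𝒜 𝒩 p n) :
    ∃ l ∈ homogCocycles x 𝒜 ℒ p n, c - map x φ l ∈ homogCoboundaries x 𝒜 ℳ p n := by
  obtain ⟨b, hb, hbc⟩ := mem_homogCoboundaries.1 hψ
  obtain ⟨b, hb', rfl⟩ := exists_lift_homogCochains h hb
  obtain ⟨l, hl, hlc⟩ := exists_of_map_eq_zero_homogCochains h hx
    (sub_mem hc.1 (d_mem_homogCochains hb')) (by rw [map_sub, map_d, hbc, sub_self])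
  refine ⟨l, mem_homogCocycles.2 ⟨hl, map_injective x h.injective ?_⟩,
    mem_homogCoboundaries.2 ⟨b, hb', by rw [hlc, sub_sub_cancel]⟩⟩
  rw [map_d, hlc, map_sub, d_d, (mem_homogCocycles.1 hc).2, sub_zero, map_zero]

lemma mem_homogCoboundaries_of_map (hx : ∀ i, SetLike.IsHomogeneousElem 𝒜 (x i))
    (hL : VanishesAt x 𝒜 ℒ p n) {c : Total x M} (hc : c ∈ homogCocycles x 𝒜 ℳ p n)
    (hψ : map x ψ c ∈ homogCoboundaries x 𝒜 𝒩 p n) : c ∈ homogCoboundaries x 𝒜 ℳ p n := by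
  obtain ⟨l, hl, hlc⟩ := exists_sub_map_mem_homogCoboundaries h hx hc hψ
  have := map_mem_homogCoboundaries (fun e ↦ h.map_mem_left (e + n)) (hL hl)
  simpa using add_mem hlc this

omit h in
/-- The relation given by the connecting homomorphism of the long exact sequence. -/
def IsConnecting (x : Fin r → R) (𝒜 : ℕ → AddSubgroup R) [GradedRing 𝒜] (ℳ : ℤ → AddSubgroup M)
    [GradedAction 𝒜 ℳ] (φ : L →ₗ[R] M) (ψ : M →ₗ[R] N) (p : ℕ) (n : ℤ)
    (c : Total x N) (l : Total x L) : Prop :=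
  ∃ b ∈ homogCochains x 𝒜 ℳ n (p + 1), map x ψ b = c ∧ d x M b = map x φ l

lemma exists_isConnecting (hx : ∀ i, SetLike.IsHomogeneousElem 𝒜 (x i)) {c : Total x N}
    (hc : c ∈ homogCocycles x 𝒜 𝒩 p n) :
    ∃ l ∈ homogCocycles x 𝒜 ℒ (p + 1) n, IsConnecting x 𝒜 ℳ φ ψ p n c l := by
  rw [mem_homogCocycles] at hc
  obtain ⟨b, hb, rfl⟩ := exists_lift_homogCochains h hc.1
  obtain ⟨l, hl, hlb⟩ := exists_of_map_eq_zero_homogCochains h hx (d_mem_homogCochains hb)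
    (by rw [map_d, hc.2])
  refine ⟨l, mem_homogCocycles.2 ⟨hl, map_injective x h.injective ?_⟩, b, hb, rfl, hlb.symm⟩
  rw [map_d, hlb, d_d, map_zero]

omit [GradedAction 𝒜 ℒ] in
lemma exists_isConnecting_of_map_mem {l : Total x L}
    (hφ : map x φ l ∈ homogCoboundaries x 𝒜 ℳ (p + 1) n) :
    ∃ c ∈ homogCocycles x 𝒜 𝒩 p n, IsConnecting x 𝒜 ℳ φ ψ p n c l := by
  obtain ⟨b, hb, hbl⟩ := mem_homogCoboundaries.1 hφ
  refine ⟨map x ψ b, mem_homogCocycles.2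
    ⟨map_mem_homogCochains (fun e ↦ h.map_mem_right (e + n)) hb, ?_⟩, b, hb, rfl, hbl⟩
  rw [← map_d, hbl, map_map_eq_zero h]

-- Exactness at H^p(N)_n: correcting the lift b by a primitive of l turns it into a cocycle.
omit [GradedAction 𝒜 𝒩] in
lemma exists_cocycle_of_isConnecting {c : Total x N} {l : Total x L}
    (hcl : IsConnecting x 𝒜 ℳ φ ψ p n c l) (hl : l ∈ homogCoboundaries x 𝒜 ℒ (p + 1) n) :
    ∃ m ∈ homogCocycles x 𝒜 ℳ p n, map x ψ m = c := by
  obtain ⟨b, hb, rfl, hbl⟩ := hcl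
  obtain ⟨a, ha, rfl⟩ := mem_homogCoboundaries.1 hl
  refine ⟨b - map x φ a, mem_homogCocycles.2
    ⟨sub_mem hb (map_mem_homogCochains (fun e ↦ h.map_mem_left (e + n)) ha), ?_⟩, ?_⟩
  · rw [map_sub, hbl, map_d, sub_self]
  · rw [map_sub, map_map_eq_zero h, sub_zero]

lemma mem_homogCoboundaries_of_isConnecting_right (hM : VanishesAt x 𝒜 ℳ p n)
    {c : Total x N} {l : Total x L} (hcl : IsConnecting x 𝒜 ℳ φ ψ p n c l)
    (hl : l ∈ homogCoboundaries x 𝒜 ℒ (p + 1) n) : c ∈ homogCoboundaries x 𝒜 𝒩 p n := by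
  obtain ⟨m, hm, rfl⟩ := exists_cocycle_of_isConnecting h hcl hl
  exact map_mem_homogCoboundaries (fun e ↦ h.map_mem_right (e + n)) (hM hm)

/-- The connecting map is well defined on classes. Since it is only a relation on cochains here,
this is stated as zero classes being related to zero classes alone. -/
lemma mem_homogCoboundaries_of_isConnecting_left (hx : ∀ i, SetLike.IsHomogeneousElem 𝒜 (x i))
    {c : Total x N} {l : Total x L} (hcl : IsConnecting x 𝒜 ℳ φ ψ p n c l)
    (hc : c ∈ homogCoboundaries x 𝒜 𝒩 p n) : l ∈ homogCoboundaries x 𝒜 ℒ (p + 1) n := by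
  obtain ⟨b, hb, rfl, hbl⟩ := hcl
  obtain ⟨a, ha, hab⟩ := mem_homogCoboundaries.1 hc
  obtain ⟨a, ha', rfl⟩ := exists_lift_homogCochains h ha
  obtain ⟨e, he, hea⟩ := exists_of_map_eq_zero_homogCochains h hx
    (sub_mem hb (d_mem_homogCochains ha')) (by rw [map_sub, map_d, hab, sub_self])
  refine mem_homogCoboundaries.2 ⟨e, he, map_injective x h.injective ?_⟩
  rw [map_d, hea, map_sub, d_d, sub_zero, hbl]

omit h in
lemma IsConnecting.smul {c : Total x N} {l : Total x L}
    (hcl : IsConnecting x 𝒜 ℳ φ ψ p n c l) {i : ℕ} {a : R} (ha : a ∈ 𝒜 i) :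
    IsConnecting x 𝒜 ℳ φ ψ p (i + n) (a • c) (a • l) := by
  obtain ⟨b, hb, rfl, hbl⟩ := hcl
  exact ⟨a • b, smul_mem_homogCochains hb ha, map_smul _ a b, by rw [map_smul, map_smul, hbl]⟩

lemma exists_cocycle_lift (hx : ∀ i, SetLike.IsHomogeneousElem 𝒜 (x i))
    (hL : VanishesAt x 𝒜 ℒ (p + 1) n) {c : Total x N} (hc : c ∈ homogCocycles x 𝒜 𝒩 p n) :
    ∃ m ∈ homogCocycles x 𝒜 ℳ p n, map x ψ m = c := by
  obtain ⟨l, hl, hcl⟩ := exists_isConnecting h hx hc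
  exact exists_cocycle_of_isConnecting h hcl (hL hl)

lemma vanishesAt_right (hx : ∀ i, SetLike.IsHomogeneousElem 𝒜 (x i))
    (hL : VanishesAt x 𝒜 ℒ (p + 1) n) (hM : VanishesAt x 𝒜 ℳ p n) : VanishesAt x 𝒜 𝒩 p n := by
  intro c hc
  obtain ⟨l, hl, hcl⟩ := exists_isConnecting h hx hc
  exact mem_homogCoboundaries_of_isConnecting_right h hM hcl (hL hl)

end LongExactSequence

/-! ### Comparison of the graded component of cohomology with homogeneous cochains. -/

section Projection

variable {R : Type*} [CommRing R] {r : ℕ} {x : Fin r → R}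
  {𝒜 : ℕ → AddSubgroup R} [GradedRing 𝒜] (hx : ∀ i, SetLike.IsHomogeneousElem 𝒜 (x i))
  {M : Type*} [AddCommGroup M] [Module R M]
  (ℳ : ℤ → AddSubgroup M) [GradedAction 𝒜 ℳ] [DirectSum.Decomposition ℳ]
include hx

lemma isInternal_totalComponent : DirectSum.IsInternal (totalComponent x 𝒜 ℳ) := by
  classical
  have hI : ∀ I : Finset (Fin r), DirectSum.IsInternal (locComponent 𝒜 ℳ (denom x I)) := fun I ↦
    isInternal_locComponent 𝒜 ℳ fun s hs ↦ isHomogeneousElem_of_mem_denom x 𝒜 hx hs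
  let _ := fun I ↦ (hI I).chooseDecomposition
  refine isInternal_of_forall_sum _ (fun F f hf h n hn ↦ ?_) fun m ↦ ?_
  · funext I
    have := homogComponent_sum_of_mem (locComponent 𝒜 ℳ (denom x I)) (f := fun n ↦ f n I)
      (fun n ↦ (mem_totalComponent x 𝒜 ℳ).1 (hf n) I) hn
    rw [← this, ← Finset.sum_apply, h]
    simp
  · choose F hF hFs using fun I ↦
      exists_sum_homogComponent (locComponent 𝒜 ℳ (denom x I)) (m I)
    refine ⟨Finset.univ.biUnion F,
      fun n I ↦ homogComponent (locComponent 𝒜 ℳ (denom x I)) n (m I),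
      fun n ↦ (mem_totalComponent x 𝒜 ℳ).2 fun I ↦ homogComponent_mem _ _ _, ?_⟩
    funext I
    rw [Finset.sum_apply]
    conv_rhs => rw [← hFs I]
    exact (Finset.sum_subset (Finset.subset_biUnion_of_mem F (Finset.mem_univ I))
      fun n _ hn ↦ hF I n hn).symm

variable [DirectSum.Decomposition (totalComponent x 𝒜 ℳ)]

omit hx [DirectSum.Decomposition ℳ] in
lemma homogComponent_d (n : ℤ) (c : Total x M) :
    homogComponent (totalComponent x 𝒜 ℳ) n (d x M c) =
      d x M (homogComponent (totalComponent x 𝒜 ℳ) n c) :=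
  (map_homogComponent _ _ (d x M).toAddMonoidHom
    (fun _ _ ↦ d_mem_totalComponent x 𝒜 ℳ) n c).symm

omit hx [DirectSum.Decomposition ℳ] in
lemma homogComponent_mem_cochains (n : ℤ) {p : ℕ} {c : Total x M} (hc : c ∈ cochains x M p) :
    homogComponent (totalComponent x 𝒜 ℳ) n c ∈ cochains x M p := by
  intro I hI
  classical
  -- Restriction to the coordinate I preserves degrees, hence commutes with taking components.
  let e : Total x M →+ Total x M := AddMonoidHom.single _ I |>.comp (Pi.evalAddMonoidHom _ I)
  have h := map_homogComponent (totalComponent x 𝒜 ℳ) (totalComponent x 𝒜 ℳ) e ?_ n c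
  · have h0 : e c = 0 := by simp [e, hc I hI]
    rw [h0, map_zero] at h
    simpa [e] using congrFun h I
  · intro k b hb
    rw [mem_totalComponent] at hb ⊢
    intro J
    by_cases hJ : J = I
    · subst hJ
      simpa [e] using hb J
    · simp [e, hJ]

omit [DirectSum.Decomposition (totalComponent x 𝒜 ℳ)] in
lemma mem_homogCoboundaries_of_mem_coboundaries {p : ℕ} {n : ℤ} {c : Total x M}
    (hc : c ∈ coboundaries x M p) (hn : c ∈ totalComponent x 𝒜 ℳ n) :
    c ∈ homogCoboundaries x 𝒜 ℳ p n := by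
  let _ := (isInternal_totalComponent hx ℳ).chooseDecomposition
  cases p with
  | zero => rw [(Submodule.mem_bot R).1 hc]; exact zero_mem _
  | succ p =>
    obtain ⟨b, hb, rfl⟩ := hc
    refine mem_homogCoboundaries.2 ⟨homogComponent (totalComponent x 𝒜 ℳ) n b,
      ⟨homogComponent_mem_cochains ℳ n hb, homogComponent_mem _ _ _⟩, ?_⟩
    rw [← homogComponent_d, homogComponent_of_mem hn]

omit hx [DirectSum.Decomposition ℳ] [DirectSum.Decomposition (totalComponent x 𝒜 ℳ)] in
lemma mem_coboundaries_of_mem_homogCoboundaries {p : ℕ} {n : ℤ} {c : Total x M}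
    (hc : c ∈ homogCoboundaries x 𝒜 ℳ p n) : c ∈ coboundaries x M p := by
  obtain ⟨b, hb, rfl⟩ := hc
  cases p with
  | zero => rw [AddSubgroup.mem_bot.1 hb, map_zero]; exact zero_mem _
  | succ p => exact ⟨b, hb.1, rfl⟩

-- A primitive of a homogeneous coboundary may be replaced by its component of degree n, because the
-- differential has degree zero. Thus the component of H is computed by homogeneous cochains alone.
omit [DirectSum.Decomposition (totalComponent x 𝒜 ℳ)] in
lemma component_eq_bot_iff (p : ℕ) (n : ℤ) :
    component x 𝒜 ℳ p n = ⊥ ↔ VanishesAt x 𝒜 ℳ p n := by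
  rw [component, eq_bot_iff]
  constructor
  · intro h c hc
    have h' : (Submodule.Quotient.mk ⟨c, hc.1.1, hc.2⟩ : H x M p) = 0 :=
      AddSubgroup.mem_bot.1 (h ⟨⟨c, hc.1.1, hc.2⟩, hc.1.2, rfl⟩)
    rw [Submodule.Quotient.mk_eq_zero] at h'
    exact mem_homogCoboundaries_of_mem_coboundaries hx ℳ h' hc.1.2
  · rintro h _ ⟨⟨c, hc⟩, hn, rfl⟩
    exact AddSubgroup.mem_bot.2 ((Submodule.Quotient.mk_eq_zero _).2
      (mem_coboundaries_of_mem_homogCoboundaries ℳ (h ⟨⟨hc.1, hn⟩, hc.2⟩)))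

end Projection

end Cech

/-! ### Degrees of finitely generated graded modules. -/

section Degrees

variable {R : Type*} [CommRing R] (𝒜 : ℕ → AddSubgroup R) [GradedRing 𝒜]
  {M : Type*} [AddCommGroup M] [Module R M]
  (ℳ : ℤ → AddSubgroup M) [GradedAction 𝒜 ℳ] [DirectSum.Decomposition ℳ]

-- The set Q collects degrees that cannot be reached from the generators. A component of a • m in
-- degree n ∈ Q comes from degree n - i, again in Q, unless a acts as zero. Taking a lower half-line
-- gives boundedness below; taking the complement of a finite set treats modules killed by R₊.
include 𝒜 in
lemma grading_eq_bot_of_span {Q : Set ℤ}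
    (hQ : ∀ i : ℕ, ∀ n ∈ Q, n - i ∈ Q ∨ ∀ a ∈ 𝒜 i, ∀ m : M, a • m = 0)
    {G : Set M} (hG : Submodule.span R G = ⊤)
    (hGQ : ∀ g ∈ G, ∀ n ∈ Q, homogComponent ℳ n g = 0) (n : ℤ) (hn : n ∈ Q) : ℳ n = ⊥ := by
  have key : ∀ m : M, ∀ n ∈ Q, homogComponent ℳ n m = 0 := by
    intro m
    have hm : m ∈ Submodule.span R G := hG ▸ Submodule.mem_top
    induction hm using Submodule.span_induction with
    | mem g hg => exact hGQ g hg
    | zero => simp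
    | add a b _ _ ha hb => intro n hn; rw [map_add, ha n hn, hb n hn, add_zero]
    | smul a m _ hm =>
      intro n hn
      induction a using DirectSum.Decomposition.inductionOn 𝒜 with
      | zero => simp
      | @homogeneous i a =>
        rcases hQ i n hn with h | h
        · have := homogComponent_smul 𝒜 ℳ a.2 (n - i) m
          rwa [add_sub_cancel, hm _ h, smul_zero] at this
        · rw [h a a.2, map_zero]
      | add a b ha hb => rw [add_smul, map_add, ha, hb, add_zero]
  exact (AddSubgroup.eq_bot_iff_forall _).2 fun m hm ↦ by
    rw [← homogComponent_of_mem hm, key m n hn]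

variable [Module.Finite R M]

variable (R) in
omit [GradedAction 𝒜 ℳ] [GradedRing 𝒜] in
lemma exists_finset_degrees : ∃ (G : Set M) (F : Finset ℤ), Submodule.span R G = ⊤ ∧
    ∀ g ∈ G, ∀ n ∉ F, homogComponent ℳ n g = 0 := by
  classical
  obtain ⟨G, hG⟩ := Module.Finite.fg_top (R := R) (M := M)
  choose F hF _ using exists_sum_homogComponent ℳ
  exact ⟨G, G.biUnion F, hG, fun g hg n hn ↦
    hF g n fun h ↦ hn (Finset.mem_biUnion.2 ⟨g, hg, h⟩)⟩

include 𝒜 in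
lemma exists_forall_lt_grading_eq_bot : ∃ N : ℤ, ∀ n < N, ℳ n = ⊥ := by
  obtain ⟨G, F, hG, hF⟩ := exists_finset_degrees R ℳ
  obtain ⟨N, hN⟩ := F.bddBelow
  refine ⟨N, fun n hn ↦ grading_eq_bot_of_span 𝒜 ℳ (Q := Set.Iio N) (fun i n hn ↦ Or.inl ?_) hG
    (fun g hg n hn ↦ hF g hg n fun h ↦ not_lt.2 (hN h) hn) n hn⟩
  simp only [Set.mem_Iio] at *
  omega

include 𝒜 in
lemma exists_finset_grading_eq_bot (hkill : ∀ i : ℕ, 0 < i → ∀ a ∈ 𝒜 i, ∀ m : M, a • m = 0) :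
    ∃ F : Finset ℤ, ∀ n ∉ F, ℳ n = ⊥ := by
  obtain ⟨G, F, hG, hF⟩ := exists_finset_degrees R ℳ
  refine ⟨F, grading_eq_bot_of_span 𝒜 ℳ (Q := {n | n ∉ F}) (fun i n hn ↦ ?_) hG hF⟩
  rcases Nat.eq_zero_or_pos i with rfl | hi
  · exact Or.inl (by simpa using hn)
  · exact Or.inr (hkill i hi)

end Degrees

namespace Cech

/-! ### Direct vanishing results for Čech cohomology. -/

section Vanishing

variable {R : Type*} [CommRing R] {r : ℕ} {x : Fin r → R}
  {𝒜 : ℕ → AddSubgroup R} [GradedRing 𝒜] {M : Type*} [AddCommGroup M] [Module R M]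
  {ℳ : ℤ → AddSubgroup M} [GradedAction 𝒜 ℳ]

/-- The cochains themselves vanish: a denominator of positive degree kills its numerator, and one of
degree zero leaves the numerator in degree n. -/
lemma vanishesAt_of_grading_eq_bot (hkill : ∀ i : ℕ, 0 < i → ∀ a ∈ 𝒜 i, ∀ m : M, a • m = 0)
    {n : ℤ} (hn : ℳ n = ⊥) (p : ℕ) : VanishesAt x 𝒜 ℳ p n := by
  intro c hc
  have h0 : c = 0 := by
    funext I
    obtain ⟨e, m, s, hs, hm, h⟩ := (mem_totalComponent x 𝒜 ℳ).1 hc.1.2 I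
    rw [h, Pi.zero_apply, mk_eq_zero_iff]
    refine ⟨s, ?_⟩
    rcases Nat.eq_zero_or_pos e with rfl | he
    · have : m = 0 := by simpa [hn] using hm
      rw [this, smul_zero]
    · exact hkill e he s hs m
  rw [h0]
  exact zero_mem _

lemma vanishesAt_zero {N : ℤ} (hN : ∀ n < N, ℳ n = ⊥) {n : ℤ} (hn : n < N) :
    VanishesAt x 𝒜 ℳ 0 n := by
  intro c hc
  have h0 : c = 0 := by
    funext I
    by_cases hI : I.card = 0
    · obtain rfl := Finset.card_eq_zero.1 hI
      obtain ⟨e, m, s, hs, hm, h⟩ := (mem_totalComponent x 𝒜 ℳ).1 hc.1.2 ∅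
      have hs1 : (s : R) = 1 := by
        have := s.2
        simpa [denom] using this
      rw [h, Pi.zero_apply, mk_eq_zero_iff]
      refine ⟨1, ?_⟩
      rw [one_smul]
      -- The denominator is 1, whose degree is determined only if the ring is non-zero.
      by_cases h1 : (1 : R) = 0
      · rw [← one_smul R m, h1, zero_smul]
      · rw [hs1] at hs
        obtain rfl := DirectSum.degree_eq_of_mem_mem 𝒜 hs SetLike.GradedOne.one_mem h1
        simpa [hN n hn] using hm
    · exact hc.1.1 I hI
  rw [h0]
  exact zero_mem _

end Vanishing

/-! ### Čech cohomology is torsion for the ideal of the generators. -/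

section Torsion

variable {R : Type*} [CommRing R] {r : ℕ} {x : Fin r → R} {M : Type*} [AddCommGroup M] [Module R M]

lemma exists_eq_pow_mul_of_mem_denom {I J : Finset (Fin r)} {j : Fin r} (hJ : J ⊆ insert j I)
    {s : R} (hs : s ∈ denom x J) : ∃ (k : ℕ) (t : denom x I), s = x j ^ k * t := by
  induction hs using Submonoid.closure_induction with
  | mem s hs =>
    obtain ⟨i, hi, rfl⟩ := hs
    rcases Finset.mem_insert.1 (hJ hi) with rfl | hi
    · exact ⟨1, 1, by simp⟩
    · exact ⟨0, ⟨x i, Submonoid.subset_closure ⟨i, hi, rfl⟩⟩, by simp⟩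
  | one => exact ⟨0, 1, by simp⟩
  | mul a b _ _ ha hb =>
    obtain ⟨k, t, rfl⟩ := ha
    obtain ⟨k', t', rfl⟩ := hb
    exact ⟨k + k', t * t', by rw [pow_add, Submonoid.coe_mul]; ring⟩

lemma pow_mem_denom {J : Finset (Fin r)} {j : Fin r} (hj : j ∈ J) (k : ℕ) :
    x j ^ k ∈ denom x J :=
  pow_mem (Submonoid.subset_closure (Set.mem_image_of_mem x hj)) k

lemma exists_res_eq_pow_smul {I J : Finset (Fin r)} {j : Fin r} (hIJ : I ⊆ J)
    (hJ : J ⊆ insert j I) (hj : j ∈ J) (z : LocalizedModule (denom x J) M) :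
    ∃ (k : ℕ) (w : LocalizedModule (denom x I) M), res x M hIJ w = x j ^ k • z := by
  obtain ⟨m, s, rfl⟩ := exists_eq_mk z
  obtain ⟨k, t, hs⟩ := exists_eq_pow_mul_of_mem_denom hJ s.2
  refine ⟨k, LocalizedModule.mk m t, ?_⟩
  have hs' : s = (⟨x j ^ k, pow_mem_denom hj k⟩ : denom x J) * ⟨t, denom_mono x hIJ t.2⟩ :=
    Subtype.ext hs
  rw [res_mk, LocalizedModule.smul'_mk, hs']
  exact (LocalizedModule.mk_cancel_common_left (⟨x j ^ k, pow_mem_denom hj k⟩ : denom x J) _ m).symm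

lemma exists_pow_smul_eq_zero_of_res_eq_zero {I J : Finset (Fin r)} {j : Fin r} (hIJ : I ⊆ J)
    (hJ : J ⊆ insert j I) {w : LocalizedModule (denom x I) M} (hw : res x M hIJ w = 0) :
    ∃ k : ℕ, x j ^ k • w = 0 := by
  obtain ⟨m, s, rfl⟩ := exists_eq_mk w
  rw [res_mk, mk_eq_zero_iff] at hw
  obtain ⟨u, hu⟩ := hw
  obtain ⟨k, t, hut⟩ := exists_eq_pow_mul_of_mem_denom hJ u.2
  refine ⟨k, ?_⟩
  rw [LocalizedModule.smul'_mk, mk_eq_zero_iff]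
  refine ⟨t, ?_⟩
  have hu' : (u : R) • m = 0 := hu
  change (t : R) • x j ^ k • m = 0
  rwa [smul_smul, mul_comm, ← hut]

lemma sign_smul_sign_smul (J : Finset (Fin r)) (j : Fin r) {A : Type*} [AddCommGroup A]
    [Module R A] (a : A) : sign R J j • sign R J j • a = a := by
  rw [smul_smul, sign, ← mul_pow]
  simp

lemma d_apply_of_forall_mem_eq_zero {c : Total x M} {j : Fin r} (hc : ∀ I, j ∈ I → c I = 0)
    {J : Finset (Fin r)} (hj : j ∈ J) :
    d x M c J = sign R J j • res x M (J.erase_subset j) (c (J.erase j)) := by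
  rw [d_apply, Finset.sum_eq_single j]
  · intro i _ hij
    rw [hc _ (Finset.mem_erase.2 ⟨hij.symm, hj⟩), map_zero, smul_zero]
  · exact fun h ↦ absurd hj h

/-- After inverting x j, moving the index j out of J is a contracting homotopy. Without inverting
it, the homotopy b exists after multiplication by a power of x j and works up to a cochain e killed
by a further power; finiteness of the index sets makes both powers uniform. -/
lemma exists_pow_smul_generator_mem_coboundaries {p : ℕ} {c : Total x M}
    (hc : c ∈ cocycles x M p) (j : Fin r) : ∃ k : ℕ, x j ^ k • c ∈ coboundaries x M p := by
  have key : ∀ I : Finset (Fin r), ∃ (k : ℕ) (w : LocalizedModule (denom x I) M),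
      (j ∈ I → w = 0) ∧ (I.card + 1 ≠ p → w = 0) ∧ ∀ (J : Finset (Fin r)) (h : I ⊆ J), j ∈ J →
        I = J.erase j → res x M h w = sign R J j • x j ^ k • c J := by
    intro I
    by_cases hj : j ∈ I
    · exact ⟨0, 0, fun _ ↦ rfl, fun _ ↦ rfl, fun J _ _ h ↦ absurd hj (h ▸ Finset.notMem_erase j J)⟩
    have hJI : ∀ J : Finset (Fin r), j ∈ J → I = J.erase j → J = insert j I := by
      rintro J hJ rfl
      exact (Finset.insert_erase hJ).symm
    by_cases hp : I.card + 1 = p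
    · obtain ⟨k, w, hw⟩ := exists_res_eq_pow_smul (I.subset_insert j) (Finset.Subset.refl _)
        (I.mem_insert_self j) (c (insert j I))
      refine ⟨k, sign R (insert j I) j • w, fun h ↦ absurd h hj, fun h ↦ absurd hp h,
        fun J h hJ hI ↦ ?_⟩
      obtain rfl := hJI J hJ hI
      rw [map_smul, hw]
    · refine ⟨0, 0, fun _ ↦ rfl, fun _ ↦ rfl, fun J h hJ hI ↦ ?_⟩
      obtain rfl := hJI J hJ hI
      rw [hc.1 _ (by rwa [Finset.card_insert_of_notMem hj]), smul_zero, smul_zero, map_zero]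
  choose k w hwj hwp hw using key
  let K := Finset.univ.sup k
  let b : Total x M := fun I ↦ x j ^ (K - k I) • w I
  have hb : ∀ I, j ∈ I → b I = 0 := fun I hI ↦ by simp only [b, hwj I hI, smul_zero]
  have hbd : ∀ J, j ∈ J → d x M b J = x j ^ K • c J := by
    intro J hJ
    rw [d_apply_of_forall_mem_eq_zero hb hJ]
    simp only [b]
    rw [map_smul, hw _ J _ hJ rfl, smul_comm (x j ^ _) (sign R J j), sign_smul_sign_smul, smul_smul,
      ← pow_add, Nat.sub_add_cancel (Finset.le_sup (Finset.mem_univ _))]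
  -- This cocycle vanishes on index sets containing j, so on such a J its differential is, up to
  -- sign, the restriction of its value at J without j. That restriction is zero, which forces x
  -- j-power torsion.
  let e : Total x M := d x M b - x j ^ K • c
  have he : ∀ I, j ∈ I → e I = 0 := fun I hI ↦ by
    simp only [e, Pi.sub_apply, Pi.smul_apply, hbd I hI, sub_self]
  have hde : d x M e = 0 := by
    have : d x M c = 0 := hc.2
    simp only [e, map_sub, map_smul, d_d, this, smul_zero, sub_zero]
  have htor : ∀ J : Finset (Fin r), j ∈ J → ∃ l : ℕ, x j ^ l • e (J.erase j) = 0 := by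
    intro J hJ
    have h0 := congrFun hde J
    rw [d_apply_of_forall_mem_eq_zero he hJ] at h0
    refine exists_pow_smul_eq_zero_of_res_eq_zero (J.erase_subset j)
      (Finset.insert_erase hJ).ge ?_
    rw [← sign_smul_sign_smul (R := R) J j (res x M _ _), h0, Pi.zero_apply, smul_zero]
  have htor' : ∀ I, ∃ l : ℕ, x j ^ l • e I = 0 := by
    intro I
    by_cases hI : j ∈ I
    · exact ⟨0, by rw [he I hI, smul_zero]⟩
    · have := htor (insert j I) (I.mem_insert_self j)
      rwa [Finset.erase_insert hI] at this
  choose l hl using htor'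
  let L := Finset.univ.sup l
  have hL : x j ^ L • e = 0 := by
    funext I
    have hle : l I ≤ L := Finset.le_sup (Finset.mem_univ I)
    rw [Pi.smul_apply, ← Nat.sub_add_cancel hle, pow_add, mul_smul, hl, smul_zero, Pi.zero_apply]
  refine ⟨L + K, ?_⟩
  have hLe : x j ^ (L + K) • c = d x M (x j ^ L • b) := by
    simp only [e, smul_sub, sub_eq_zero] at hL
    rw [map_smul, hL, smul_smul, pow_add]
  rw [hLe]
  cases p with
  | zero =>
    have : b = 0 := by
      funext I
      simp only [b, hwp I (Nat.succ_ne_zero _), smul_zero, Pi.zero_apply]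
    rw [this, smul_zero, map_zero]
    exact zero_mem _
  | succ p =>
    refine ⟨_, Submodule.smul_mem _ _ fun I hI ↦ ?_, rfl⟩
    simp only [b, hwp I (by omega), smul_zero]

lemma exists_pow_smul_mem_coboundaries {p : ℕ} {c : Total x M} (hc : c ∈ cocycles x M p) {a : R}
    (ha : a ∈ Ideal.span (Set.range x)) : ∃ k : ℕ, a ^ k • c ∈ coboundaries x M p := by
  let Q : Ideal R := (coboundaries x M p).comap (LinearMap.toSpanSingleton R (Total x M) c)
  have hQ : Ideal.span (Set.range x) ≤ Q.radical := by
    rw [Ideal.span_le]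
    rintro _ ⟨j, rfl⟩
    exact exists_pow_smul_generator_mem_coboundaries hc j
  exact hQ ha

end Torsion

/-! ### Passing a map through its kernel, image and cokernel. -/

section KernelCokernel

variable {R : Type*} [CommRing R] {r : ℕ} {x : Fin r → R}
  {𝒜 : ℕ → AddSubgroup R} [GradedRing 𝒜]
  {M N : Type*} [AddCommGroup M] [Module R M] [AddCommGroup N] [Module R N]
  {ℳ : ℤ → AddSubgroup M} {𝒩 : ℤ → AddSubgroup N} {φ : M →ₗ[R] N}

lemma isGradedShortExact_ker [DirectSum.Decomposition ℳ] [DirectSum.Decomposition 𝒩]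
    (hφ : ∀ n, ∀ m ∈ ℳ n, φ m ∈ 𝒩 n) :
    IsGradedShortExact (subGrading ℳ (LinearMap.ker φ)) ℳ (subGrading 𝒩 (LinearMap.range φ))
      (LinearMap.ker φ).subtype φ.rangeRestrict where
  injective := Subtype.val_injective
  map_mem_left _ _ hl := hl
  map_mem_right n m hm := hφ n m hm
  comp_eq_zero := by
    ext m
    exact m.2
  exists_of_map_eq_zero n m hm h := ⟨⟨m, congrArg Subtype.val h⟩, hm, rfl⟩
  exists_lift := by
    rintro n ⟨_, m, rfl⟩ hm
    refine ⟨homogComponent ℳ n m, homogComponent_mem ℳ n m, Subtype.ext ?_⟩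
    exact (map_homogComponent ℳ 𝒩 φ.toAddMonoidHom hφ n m).trans (homogComponent_of_mem hm)

variable (𝒩) in
lemma isGradedShortExact_mkQ (P : Submodule R N) :
    IsGradedShortExact (subGrading 𝒩 P) 𝒩 (quotGrading 𝒩 P) P.subtype P.mkQ where
  injective := Subtype.val_injective
  map_mem_left _ _ hl := hl
  map_mem_right n m hm := ⟨m, hm, rfl⟩
  comp_eq_zero := by
    ext m
    simp
  exists_of_map_eq_zero n m hm h := ⟨⟨m, by simpa using h⟩, hm, rfl⟩
  exists_lift _ _ := id

lemma map_subtype_map_rangeRestrict (c : Total x M) :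
    map x (LinearMap.range φ).subtype (map x φ.rangeRestrict c) = map x φ c := by
  rw [map_map]
  rfl

variable [GradedAction 𝒜 ℳ] [GradedAction 𝒜 𝒩] [DirectSum.Decomposition ℳ]
  [DirectSum.Decomposition 𝒩]

/-- Injectivity of H^p(φ)_n: H^p of the kernel controls M → image, and H^{p-1} of the cokernel
controls image → N. The condition on q makes the second requirement void at p = 0. -/
lemma mem_homogCoboundaries_of_map_of_ker_of_coker (hφ : ∀ n, ∀ m ∈ ℳ n, φ m ∈ 𝒩 n)
    (hx : ∀ i, SetLike.IsHomogeneousElem 𝒜 (x i)) {p : ℕ} {n : ℤ}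
    (hT : VanishesAt x 𝒜 (subGrading ℳ (LinearMap.ker φ)) p n)
    (hC : ∀ q, p = q + 1 → VanishesAt x 𝒜 (quotGrading 𝒩 (LinearMap.range φ)) q n)
    {c : Total x M} (hc : c ∈ homogCocycles x 𝒜 ℳ p n)
    (hφc : map x φ c ∈ homogCoboundaries x 𝒜 𝒩 p n) : c ∈ homogCoboundaries x 𝒜 ℳ p n := by
  refine mem_homogCoboundaries_of_map (isGradedShortExact_ker hφ) hx hT hc ?_
  rw [← map_subtype_map_rangeRestrict] at hφc
  have hQ := isGradedShortExact_mkQ 𝒩 (LinearMap.range φ)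
  cases p with
  | zero =>
    obtain ⟨b, hb, hbc⟩ := hφc
    rw [AddSubgroup.mem_bot.1 hb, map_zero] at hbc
    rw [map_injective x hQ.injective (hbc.symm.trans (map_zero _).symm)]
    exact zero_mem _
  | succ q =>
    obtain ⟨a, ha, hal⟩ := exists_isConnecting_of_map_mem hQ hφc
    exact mem_homogCoboundaries_of_isConnecting_left hQ hx hal (hC q rfl ha)

end KernelCokernel

/-! ### Multiplication by a family of degree-one elements. -/

section MulFamily

variable {R : Type*} [CommRing R] {r : ℕ} {x : Fin r → R}
  {𝒜 : ℕ → AddSubgroup R} [GradedRing 𝒜] {M : Type*} [AddCommGroup M] [Module R M]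
  {ℳ : ℤ → AddSubgroup M} [GradedAction 𝒜 ℳ] {ι : Type*} {y : ι → R}

variable (M y) in
/-- The map `m ↦ (yₖ m)ₖ`. -/
def mulFamily : M →ₗ[R] (ι → M) :=
  LinearMap.pi fun k ↦ y k • LinearMap.id

variable (hy : ∀ k, y k ∈ 𝒜 1)

omit [GradedRing 𝒜] in
lemma smul_mem_succ {a : R} (ha : a ∈ 𝒜 1) {n : ℤ} {m : M} (hm : m ∈ ℳ n) : a • m ∈ ℳ (n + 1) := by
  have := GradedAction.smul_mem (ℳ := ℳ) ha hm
  rwa [Nat.cast_one, add_comm] at this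

include hy in
omit [GradedRing 𝒜] in
lemma mulFamily_mem (n : ℤ) (m : M) (hm : m ∈ ℳ n) :
    mulFamily M y m ∈ piShiftGrading ℳ ι n :=
  mem_piShiftGrading.2 fun k ↦ smul_mem_succ (hy k) hm

omit [GradedAction 𝒜 ℳ] [GradedRing 𝒜] in
lemma proj_mem_of_mem_piShiftGrading (k : ι) (n : ℤ) (e : ℕ) (f : ι → M)
    (hf : f ∈ piShiftGrading ℳ ι (e + n)) : LinearMap.proj (R := R) k f ∈ ℳ (e + (n + 1)) := by
  rw [← add_assoc]
  exact mem_piShiftGrading.1 hf k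

omit [GradedAction 𝒜 ℳ] [GradedRing 𝒜] in
lemma single_mem_piShiftGrading [DecidableEq ι] (k : ι) (n : ℤ) (e : ℕ) (m : M)
    (hm : m ∈ ℳ (e + (n + 1))) :
    LinearMap.single R (fun _ ↦ M) k m ∈ piShiftGrading ℳ ι (e + n) := by
  rw [← add_assoc] at hm
  refine mem_piShiftGrading.2 fun j ↦ ?_
  by_cases h : j = k
  · subst h
    simpa using hm
  · simp [h]

lemma smul_mem_of_map_mulFamily_mem {p : ℕ} {n : ℤ} {c : Total x M}
    (hc : map x (mulFamily M y) c ∈ homogCoboundaries x 𝒜 (piShiftGrading ℳ ι) p n) (k : ι) :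
    y k • c ∈ homogCoboundaries x 𝒜 ℳ p (n + 1) := by
  have := map_mem_homogCoboundaries (proj_mem_of_mem_piShiftGrading (R := R) k n) hc
  rw [map_map] at this
  rwa [← map_smul_id]

lemma map_mem_of_forall_proj_mem [Fintype ι] {p : ℕ} {n : ℤ} {c : Total x (ι → M)}
    (hc : ∀ k, map x (LinearMap.proj k) c ∈ homogCoboundaries x 𝒜 ℳ p (n + 1)) :
    c ∈ homogCoboundaries x 𝒜 (piShiftGrading ℳ ι) p n := by
  classical
  have hid : (LinearMap.id : (ι → M) →ₗ[R] (ι → M)) =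
      ∑ k, LinearMap.single R (fun _ ↦ M) k ∘ₗ LinearMap.proj k := by
    ext k m j
    simp
  rw [← map_id x c, hid, map_sum_left]
  refine sum_mem fun k _ ↦ ?_
  rw [← map_map]
  exact map_mem_homogCoboundaries (single_mem_piShiftGrading k n) (hc k)

lemma map_mulFamily_mem [Fintype ι] {p : ℕ} {n : ℤ} {c : Total x M}
    (hc : ∀ k, y k • c ∈ homogCoboundaries x 𝒜 ℳ p (n + 1)) :
    map x (mulFamily M y) c ∈ homogCoboundaries x 𝒜 (piShiftGrading ℳ ι) p n := by
  refine map_mem_of_forall_proj_mem fun k ↦ ?_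
  rw [map_map]
  have := hc k
  rwa [← map_smul_id] at this

lemma vanishesAt_piShiftGrading [Fintype ι] {p : ℕ} {n : ℤ}
    (h : VanishesAt x 𝒜 ℳ p (n + 1)) : VanishesAt x 𝒜 (piShiftGrading ℳ ι) p n :=
  fun _ hc ↦ map_mem_of_forall_proj_mem fun k ↦
    h (map_mem_homogCocycles (proj_mem_of_mem_piShiftGrading (R := R) k n) hc)

end MulFamily

end Cech

/-- Elements congruent to their degree-zero part modulo the span form a subalgebra over the
degree-zero ring, and it contains S. -/
lemma irrelevant_eq_span_of_adjoin_eq_top {R : Type*} [CommRing R] (𝒜 : ℕ → AddSubgroup R)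
    [GradedRing 𝒜] {S : Set R} (hS : S ⊆ 𝒜 1) (hgen : Algebra.adjoin (𝒜 0) S = ⊤) :
    (HomogeneousIdeal.irrelevant 𝒜).toIdeal = Ideal.span S := by
  refine le_antisymm (fun a ha ↦ ?_) (Ideal.span_le.2 fun s hs ↦
    HomogeneousIdeal.mem_irrelevant_of_mem 𝒜 one_pos (hS hs))
  have key : ∀ a : R, a - GradedRing.projZeroRingHom 𝒜 a ∈ Ideal.span S := by
    intro a
    have ha : a ∈ Algebra.adjoin (𝒜 0) S := hgen ▸ Algebra.mem_top
    induction ha using Algebra.adjoin_induction with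
    | mem s hs =>
      have h0 : GradedRing.projZeroRingHom 𝒜 s = 0 :=
        DirectSum.decompose_of_mem_ne 𝒜 (hS hs) one_ne_zero
      rw [h0, sub_zero]
      exact Ideal.subset_span hs
    | algebraMap a =>
      have h0 : GradedRing.projZeroRingHom 𝒜 (algebraMap (𝒜 0) R a) = algebraMap (𝒜 0) R a :=
        DirectSum.decompose_of_mem_same 𝒜 a.2
      rw [h0, sub_self]
      exact zero_mem _
    | add a b _ _ ha hb =>
      rw [map_add, add_sub_add_comm]
      exact add_mem ha hb
    | mul a b _ _ ha hb =>
      have : a * b - GradedRing.projZeroRingHom 𝒜 (a * b) =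
          a * (b - GradedRing.projZeroRingHom 𝒜 b) +
            GradedRing.projZeroRingHom 𝒜 b * (a - GradedRing.projZeroRingHom 𝒜 a) := by
        rw [map_mul]
        ring
      rw [this]
      exact add_mem (Ideal.mul_mem_left _ _ hb) (Ideal.mul_mem_left _ _ ha)
  have h0 : GradedRing.projZeroRingHom 𝒜 a = 0 := (HomogeneousIdeal.mem_irrelevant_iff 𝒜 a).1 ha
  simpa [h0] using key a

namespace Cech

open Filter

universe u v

variable {R : Type u} [CommRing R] {r : ℕ} {x : Fin r → R}
  {𝒜 : ℕ → AddSubgroup R} [GradedRing 𝒜] {S : Finset R}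

lemma smul_eq_zero_of_irrelevant_le_span {M : Type*} [AddCommGroup M] [Module R M]
    (hirr : (HomogeneousIdeal.irrelevant 𝒜).toIdeal ≤ Ideal.span (S : Set R))
    (hkill : ∀ a ∈ S, ∀ m : M, a • m = 0) (i : ℕ) (hi : 0 < i) (a : R) (ha : a ∈ 𝒜 i) (m : M) :
    a • m = 0 := by
  have hle : Ideal.span (S : Set R) ≤ Module.annihilator R M :=
    Ideal.span_le.2 fun s hs ↦ Module.mem_annihilator.2 (hkill s hs)
  exact Module.mem_annihilator.1 (hle (hirr (HomogeneousIdeal.mem_irrelevant_of_mem 𝒜 hi ha))) m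

section Torsion

variable {M : Type*} [AddCommGroup M] [Module R M] {ℳ : ℤ → AddSubgroup M} [GradedAction 𝒜 ℳ]

lemma smul_mem_homogCocycles_succ {p : ℕ} {n : ℤ} {c : Total x M}
    (hc : c ∈ homogCocycles x 𝒜 ℳ p n) {a : R} (ha : a ∈ 𝒜 1) :
    a • c ∈ homogCocycles x 𝒜 ℳ p (n + 1) := by
  have := smul_mem_homogCocycles hc ha
  rwa [Nat.cast_one, add_comm] at this

/-- A power of y kills each class, while multiplication by y is injective from degree N upwards and
never leaves that range. -/
lemma vanishesAt_of_smul_injective (hx : ∀ i, SetLike.IsHomogeneousElem 𝒜 (x i))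
    [DirectSum.Decomposition ℳ] {y : R} (hy : y ∈ 𝒜 1) (hyx : y ∈ Ideal.span (Set.range x))
    {p : ℕ} {N : ℤ} (hinj : ∀ n ≥ N, ∀ c ∈ homogCocycles x 𝒜 ℳ p n,
      y • c ∈ homogCoboundaries x 𝒜 ℳ p (n + 1) → c ∈ homogCoboundaries x 𝒜 ℳ p n)
    {n : ℤ} (hn : N ≤ n) : VanishesAt x 𝒜 ℳ p n := by
  have key : ∀ k : ℕ, ∀ n ≥ N, ∀ c ∈ homogCocycles x 𝒜 ℳ p n,
      y ^ k • c ∈ coboundaries x M p → c ∈ homogCoboundaries x 𝒜 ℳ p n := by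
    intro k
    induction k with
    | zero =>
      intro n _ c hc h
      rw [pow_zero, one_smul] at h
      exact mem_homogCoboundaries_of_mem_coboundaries hx ℳ h hc.1.2
    | succ k ih =>
      intro n hn c hc h
      refine hinj n hn c hc (ih (n + 1) (by omega) _ (smul_mem_homogCocycles_succ hc hy) ?_)
      rwa [smul_smul, ← pow_succ]
  intro c hc
  obtain ⟨k, hk⟩ := exists_pow_smul_mem_coboundaries (p := p) (c := c) ⟨hc.1.1, hc.2⟩ hyx
  exact key k n hn c hc hk

end Torsion

/-- A class of C is sent by the connecting map to H^{p+1} of the image, where it lifts to a class m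
of H^{p+1}(M) because H^{p+2}(T)_n = 0. By exactness φ m is zero, so every y k kills m, and hence
the image of c. The connecting map is injective in degree n + 1, since H^p(M(1)^ι)_{n+1} is a power
of H^p(M)_{n+2}. -/
lemma smul_mem_homogCoboundaries_coker {M : Type*} [AddCommGroup M] [Module R M]
    {ℳ : ℤ → AddSubgroup M} [GradedAction 𝒜 ℳ] [DirectSum.Decomposition ℳ] {ι : Type*} [Fintype ι]
    {y : ι → R} (hy : ∀ k, y k ∈ 𝒜 1) (hx : ∀ i, SetLike.IsHomogeneousElem 𝒜 (x i))
    {p : ℕ} {n : ℤ}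
    (hT : VanishesAt x 𝒜 (subGrading ℳ (LinearMap.ker (mulFamily M y))) (p + 2) n)
    (hM : VanishesAt x 𝒜 ℳ p (n + 1 + 1))
    {c : Total x ((ι → M) ⧸ LinearMap.range (mulFamily M y))}
    (hc : c ∈ homogCocycles x 𝒜
      (quotGrading (piShiftGrading ℳ ι) (LinearMap.range (mulFamily M y))) p n) (k : ι) :
    y k • c ∈ homogCoboundaries x 𝒜
      (quotGrading (piShiftGrading ℳ ι) (LinearMap.range (mulFamily M y))) p (n + 1) := by
  let _ := (isInternal_piShiftGrading ℳ ι).chooseDecomposition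
  have hK := isGradedShortExact_ker (mulFamily_mem (ℳ := ℳ) hy)
  have hQ := isGradedShortExact_mkQ (piShiftGrading ℳ ι) (LinearMap.range (mulFamily M y))
  obtain ⟨l, hl, hcl⟩ := exists_isConnecting hQ hx hc
  obtain ⟨m, hm, rfl⟩ := exists_cocycle_lift hK hx hT hl
  have hφm : map x (mulFamily M y) m ∈ homogCoboundaries x 𝒜 (piShiftGrading ℳ ι) (p + 1) n := by
    obtain ⟨b, hb, -, hbl⟩ := hcl
    exact mem_homogCoboundaries.2 ⟨b, hb, by rw [hbl, map_subtype_map_rangeRestrict]⟩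
  have hal := map_mem_homogCoboundaries (fun e ↦ hK.map_mem_right (e + (n + 1)))
    (smul_mem_of_map_mulFamily_mem hφm k)
  rw [map_smul] at hal
  have hcl' := hcl.smul (hy k)
  rw [Nat.cast_one, add_comm] at hcl'
  exact mem_homogCoboundaries_of_isConnecting_right hQ (vanishesAt_piShiftGrading hM) hcl' hal

/-! ### Vanishing in high degrees, and socles in low degrees. -/

section Asymptotics

variable [IsNoetherianRing R] (hx : ∀ i, SetLike.IsHomogeneousElem 𝒜 (x i))
  (hS : (S : Set R) ⊆ 𝒜 1)
  (hirr : (HomogeneousIdeal.irrelevant 𝒜).toIdeal ≤ Ideal.span (S : Set R))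
include hx hS hirr

/-- Induction on the set S' of generators not yet known to kill the module. Both kernel and cokernel
of y : M → M(1) are killed by y as well, so by induction y is injective on cohomology in high
degrees, and torsion finishes. -/
lemma eventually_atTop_vanishesAt_of_smul_eq_zero (hSx : (S : Set R) ⊆ Ideal.span (Set.range x))
    (S' : Finset R) : ∀ (M : Type v) [AddCommGroup M] [Module R M] [Module.Finite R M]
      (ℳ : ℤ → AddSubgroup M) [DirectSum.Decomposition ℳ] [GradedAction 𝒜 ℳ],
      (∀ a ∈ S, a ∉ S' → ∀ m : M, a • m = 0) →
      ∀ p, ∀ᶠ n in atTop, VanishesAt x 𝒜 ℳ p n := by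
  classical
  induction S' using Finset.induction_on with
  | empty =>
    intro M _ _ _ ℳ _ _ hkill p
    have hkill' := smul_eq_zero_of_irrelevant_le_span (M := M) hirr fun a ha ↦ hkill a ha (by simp)
    obtain ⟨F, hF⟩ := exists_finset_grading_eq_bot 𝒜 ℳ hkill'
    obtain ⟨N, hN⟩ := F.bddAbove
    filter_upwards [eventually_gt_atTop N] with n hn
    exact vanishesAt_of_grading_eq_bot hkill' (hF n fun h ↦ not_lt.2 (hN h) hn) p
  | insert y S' _ ih =>
    intro M _ _ _ ℳ _ _ hkill p
    by_cases hyS : y ∈ S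
    swap
    · exact ih M ℳ (fun a ha haS ↦ hkill a ha fun h ↦ (Finset.mem_insert.1 h).elim
        (fun h ↦ hyS (h ▸ ha)) haS) p
    -- A one-element family, so that M(1) is treated as a power of itself.
    let φ := mulFamily M (fun _ : Unit ↦ y)
    have hφ : ∀ n, ∀ m ∈ ℳ n, φ m ∈ piShiftGrading ℳ Unit n := mulFamily_mem fun _ ↦ hS hyS
    let _ := (isInternal_piShiftGrading ℳ Unit).chooseDecomposition
    let _ := (isInternal_subGrading ℳ (LinearMap.ker φ)
      (homogComponent_mem_ker hφ)).chooseDecomposition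
    let _ := (isInternal_quotGrading (piShiftGrading ℳ Unit) (LinearMap.range φ)
      (homogComponent_mem_range hφ)).chooseDecomposition
    have hT := ih (LinearMap.ker φ) (subGrading ℳ (LinearMap.ker φ)) (by
      rintro a ha haS ⟨m, hm⟩
      refine Subtype.ext ?_
      by_cases hay : a = y
      · subst hay
        exact congrFun hm ()
      · exact hkill a ha (by simp [hay, haS]) m)
    have hC := ih ((Unit → M) ⧸ LinearMap.range φ)
      (quotGrading (piShiftGrading ℳ Unit) (LinearMap.range φ)) (by
      intro a ha haS m
      obtain ⟨f, rfl⟩ := (LinearMap.range φ).mkQ_surjective m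
      rw [← map_smul, Submodule.mkQ_apply, Submodule.Quotient.mk_eq_zero]
      by_cases hay : a = y
      · subst hay
        exact ⟨f (), rfl⟩
      · convert zero_mem (LinearMap.range φ)
        funext k
        exact hkill a ha (by simp [hay, haS]) (f k))
    have hC' : ∀ᶠ n in atTop, ∀ q, p = q + 1 →
        VanishesAt x 𝒜 (quotGrading (piShiftGrading ℳ Unit) (LinearMap.range φ)) q n := by
      cases p with
      | zero => exact Eventually.of_forall fun _ _ h ↦ absurd h (by omega)
      | succ p =>
        filter_upwards [hC p] with n hn q hq
        obtain rfl : p = q := by omega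
        exact hn
    obtain ⟨N, hN⟩ := eventually_atTop.1 ((hT p).and hC')
    filter_upwards [eventually_ge_atTop N] with n hn
    refine vanishesAt_of_smul_injective hx (hS hyS) (hSx hyS) (fun n hn c hc hyc ↦ ?_) hn
    exact mem_homogCoboundaries_of_map_of_ker_of_coker hφ hx (hN n hn).1 (hN n hn).2 hc
      (map_mulFamily_mem fun _ ↦ hyc)

lemma eventually_atTop_vanishesAt (hSx : (S : Set R) ⊆ Ideal.span (Set.range x))
    {M : Type v} [AddCommGroup M] [Module R M] [Module.Finite R M]
    (ℳ : ℤ → AddSubgroup M) [DirectSum.Decomposition ℳ] [GradedAction 𝒜 ℳ] (p : ℕ) :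
    ∀ᶠ n in atTop, VanishesAt x 𝒜 ℳ p n :=
  eventually_atTop_vanishesAt_of_smul_eq_zero hx hS hirr hSx S M ℳ (fun _ ha h ↦ absurd ha h) p

/-- If the cohomology in levels below `g` vanishes in small degrees, then in level `g` no
non-zero class of sufficiently small degree is annihilated by `R₁`. -/
lemma eventually_atBot_mem_homogCoboundaries_of_smul_mem (g : ℕ) :
    ∀ (M : Type v) [AddCommGroup M] [Module R M] [Module.Finite R M]
      (ℳ : ℤ → AddSubgroup M) [DirectSum.Decomposition ℳ] [GradedAction 𝒜 ℳ],
      (∀ j < g, ∀ᶠ n in atBot, VanishesAt x 𝒜 ℳ j n) →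
      ∀ᶠ n in atBot, ∀ c ∈ homogCocycles x 𝒜 ℳ g n,
        (∀ a ∈ S, a • c ∈ homogCoboundaries x 𝒜 ℳ g (n + 1)) →
          c ∈ homogCoboundaries x 𝒜 ℳ g n := by
  induction g with
  | zero =>
    intro M _ _ _ ℳ _ _ _
    obtain ⟨N, hN⟩ := exists_forall_lt_grading_eq_bot 𝒜 ℳ
    filter_upwards [eventually_lt_atBot N] with n hn c hc _
    exact vanishesAt_zero hN hn hc
  | succ g ih =>
    intro M _ _ _ ℳ _ _ hM
    have hshift : ∀ {P : ℤ → Prop}, (∀ᶠ n in atBot, P n) → ∀ᶠ n in atBot, P (n + 1) :=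
      fun h ↦ (tendsto_atBot_add_const_right atBot 1 tendsto_id).eventually h
    let ι := Fin S.card
    let y : ι → R := fun k ↦ S.equivFin.symm k
    have hy : ∀ k, y k ∈ 𝒜 1 := fun k ↦ hS (S.equivFin.symm k).2
    have hyS : ∀ a ∈ S, ∃ k, y k = a := fun a ha ↦ ⟨S.equivFin ⟨a, ha⟩, by simp [y]⟩
    let φ := mulFamily M y
    have hφ : ∀ n, ∀ m ∈ ℳ n, φ m ∈ piShiftGrading ℳ ι n := mulFamily_mem hy
    let _ := (isInternal_piShiftGrading ℳ ι).chooseDecomposition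
    let _ := (isInternal_subGrading ℳ (LinearMap.ker φ)
      (homogComponent_mem_ker hφ)).chooseDecomposition
    let _ := (isInternal_quotGrading (piShiftGrading ℳ ι) (LinearMap.range φ)
      (homogComponent_mem_range hφ)).chooseDecomposition
    have hK := isGradedShortExact_ker hφ
    have hQ := isGradedShortExact_mkQ (piShiftGrading ℳ ι) (LinearMap.range φ)
    have hT : ∀ p, ∀ᶠ n in atBot, VanishesAt x 𝒜 (subGrading ℳ (LinearMap.ker φ)) p n := by
      intro p
      have hkill := smul_eq_zero_of_irrelevant_le_span (M := LinearMap.ker φ) hirr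
        fun a ha m ↦ by
          obtain ⟨k, rfl⟩ := hyS a ha
          exact Subtype.ext (congrFun m.2 k)
      obtain ⟨F, hF⟩ := exists_finset_grading_eq_bot 𝒜 (subGrading ℳ (LinearMap.ker φ)) hkill
      obtain ⟨N, hN⟩ := F.bddBelow
      filter_upwards [eventually_lt_atBot N] with n hn
      exact vanishesAt_of_grading_eq_bot hkill (hF n fun h ↦ not_lt.2 (hN h) hn) p
    have hI : ∀ j < g + 1, ∀ᶠ n in atBot,
        VanishesAt x 𝒜 (subGrading (piShiftGrading ℳ ι) (LinearMap.range φ)) j n := by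
      intro j hj
      filter_upwards [hT (j + 1), hM j hj] with n hTn hMn
      exact vanishesAt_right hK hx hTn hMn
    have hN : ∀ j < g + 1, ∀ᶠ n in atBot, VanishesAt x 𝒜 (piShiftGrading ℳ ι) j n := by
      intro j hj
      filter_upwards [hshift (hM j hj)] with n hMn
      exact vanishesAt_piShiftGrading hMn
    have hC : ∀ j < g, ∀ᶠ n in atBot,
        VanishesAt x 𝒜 (quotGrading (piShiftGrading ℳ ι) (LinearMap.range φ)) j n := by
      intro j hj
      filter_upwards [hI (j + 1) (by omega), hN j (by omega)] with n hIn hNn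
      exact vanishesAt_right hQ hx hIn hNn
    -- The range of j above stops before g: reaching g would need H^{g+1} of the image. Instead the
    -- generators kill H^g(C)_n, and the induction hypothesis for C concludes.
    have hCg : ∀ᶠ n in atBot,
        VanishesAt x 𝒜 (quotGrading (piShiftGrading ℳ ι) (LinearMap.range φ)) g n := by
      have hsoc := ih ((ι → M) ⧸ LinearMap.range φ)
        (quotGrading (piShiftGrading ℳ ι) (LinearMap.range φ)) hC
      filter_upwards [hsoc, hT (g + 2), hshift (hshift (hM g (by omega)))] with n hsoc hTn hMn c hc
      refine hsoc c hc fun a ha ↦ ?_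
      obtain ⟨k, rfl⟩ := hyS a ha
      exact smul_mem_homogCoboundaries_coker hy hx hTn hMn hc k
    filter_upwards [hT (g + 1), hCg] with n hTn hCn c hc hac
    refine mem_homogCoboundaries_of_map_of_ker_of_coker hφ hx hTn ?_ hc
      (map_mulFamily_mem fun k ↦ hac (y k) (S.equivFin.symm k).2)
    intro q hq
    obtain rfl : g = q := by omega
    exact hCn

end Asymptotics

/-! ### From degrees to annihilators. -/

section Annihilator

variable {M : Type*} [AddCommGroup M] [Module R M] {ℳ : ℤ → AddSubgroup M} [GradedAction 𝒜 ℳ]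

/-- A non-zero class is pushed upwards by k generators. The last multiplication may start in degree
N, whence the bound N + 1. -/
lemma exists_smul_notMem_homogCoboundaries (hS : (S : Set R) ⊆ 𝒜 1) {p : ℕ} {N : ℤ}
    (hN : ∀ n ≤ N, ∀ c ∈ homogCocycles x 𝒜 ℳ p n,
      (∀ a ∈ S, a • c ∈ homogCoboundaries x 𝒜 ℳ p (n + 1)) → c ∈ homogCoboundaries x 𝒜 ℳ p n)
    {n : ℤ} {c : Total x M} (hc : c ∈ homogCocycles x 𝒜 ℳ p n)
    (hc' : c ∉ homogCoboundaries x 𝒜 ℳ p n) (k : ℕ) (hk : n + k ≤ N + 1) :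
    ∃ a ∈ 𝒜 k, a ∈ Ideal.span (S : Set R) ^ k ∧ a • c ∉ homogCoboundaries x 𝒜 ℳ p (n + k) := by
  induction k with
  | zero =>
    exact ⟨1, SetLike.GradedOne.one_mem, by simp, by simpa using hc'⟩
  | succ k ih =>
    push_cast at hk
    obtain ⟨a, ha, haS, hac⟩ := ih (by omega)
    have hmem := smul_mem_homogCocycles hc ha
    rw [add_comm] at hmem
    obtain ⟨s, hs, hsac⟩ : ∃ s ∈ S, s • a • c ∉ homogCoboundaries x 𝒜 ℳ p (n + k + 1) := by
      by_contra! h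
      exact hac (hN _ (by omega) _ hmem h)
    refine ⟨a * s, SetLike.GradedMul.mul_mem ha (hS hs), ?_, ?_⟩
    · rw [pow_succ]
      exact Ideal.mul_mem_mul haS (Ideal.subset_span hs)
    · rw [mul_comm, mul_smul]
      push_cast
      rwa [← add_assoc]

variable [DirectSum.Decomposition ℳ] (hx : ∀ i, SetLike.IsHomogeneousElem 𝒜 (x i))
include hx

lemma irrelevant_le_radical_annihilator (hS : (S : Set R) ⊆ 𝒜 1)
    (hirr : (HomogeneousIdeal.irrelevant 𝒜).toIdeal ≤ Ideal.span (S : Set R)) {p : ℕ}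
    (htop : ∀ᶠ n in atTop, VanishesAt x 𝒜 ℳ p n) (hbot : ∀ᶠ n in atBot, VanishesAt x 𝒜 ℳ p n) :
    (HomogeneousIdeal.irrelevant 𝒜).toIdeal ≤ (Module.annihilator R (H x M p)).radical := by
  obtain ⟨N, hN⟩ := eventually_atTop.1 htop
  obtain ⟨N', hN'⟩ := eventually_atBot.1 hbot
  let _ := (isInternal_totalComponent hx ℳ).chooseDecomposition
  -- Classes of degree at most N' are zero already; this exponent moves those of degree at least N'
  -- to degree at least N.
  refine hirr.trans (Ideal.span_le.2 fun s hs ↦ ⟨(N - N').toNat, Module.mem_annihilator.2 ?_⟩)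
  have hpow : s ^ (N - N').toNat ∈ 𝒜 (N - N').toNat := by
    simpa using SetLike.pow_mem_graded (N - N').toNat (hS hs)
  intro h
  obtain ⟨⟨c, hc⟩, rfl⟩ := Submodule.Quotient.mk_surjective _ h
  rw [← Submodule.Quotient.mk_smul, Submodule.Quotient.mk_eq_zero]
  change s ^ (N - N').toNat • c ∈ coboundaries x M p
  obtain ⟨F, -, hF⟩ := exists_sum_homogComponent (totalComponent x 𝒜 ℳ) c
  rw [← hF, Finset.smul_sum]
  refine sum_mem fun n _ ↦ ?_
  have hcn : homogComponent (totalComponent x 𝒜 ℳ) n c ∈ homogCocycles x 𝒜 ℳ p n := by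
    refine mem_homogCocycles.2
      ⟨⟨homogComponent_mem_cochains ℳ n hc.1, homogComponent_mem _ _ _⟩, ?_⟩
    rw [← homogComponent_d, LinearMap.mem_ker.1 hc.2, map_zero]
  rcases le_total n N' with hn | hn
  · exact Submodule.smul_mem _ _ (mem_coboundaries_of_mem_homogCoboundaries ℳ (hN' n hn hcn))
  · exact mem_coboundaries_of_mem_homogCoboundaries ℳ
      (hN _ (by omega) (smul_mem_homogCocycles hcn hpow))

lemma eventually_not_vanishesAt_and_not_irrelevant_le [IsNoetherianRing R]
    (hS : (S : Set R) ⊆ 𝒜 1)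
    (hirr : (HomogeneousIdeal.irrelevant 𝒜).toIdeal = Ideal.span (S : Set R)) {p : ℕ}
    (hsoc : ∀ᶠ n in atBot, ∀ c ∈ homogCocycles x 𝒜 ℳ p n,
        (∀ a ∈ S, a • c ∈ homogCoboundaries x 𝒜 ℳ p (n + 1)) → c ∈ homogCoboundaries x 𝒜 ℳ p n)
    (hp : ¬ ∀ᶠ n in atBot, VanishesAt x 𝒜 ℳ p n) :
    (∀ᶠ n in atBot, ¬ VanishesAt x 𝒜 ℳ p n) ∧
      ¬ (HomogeneousIdeal.irrelevant 𝒜).toIdeal ≤ (Module.annihilator R (H x M p)).radical := by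
  obtain ⟨N, hN⟩ := eventually_atBot.1 hsoc
  have hex : ∀ k : ℤ, ∃ n ≤ k, ∃ c ∈ homogCocycles x 𝒜 ℳ p n,
      c ∉ homogCoboundaries x 𝒜 ℳ p n := by
    intro k
    by_contra! h
    exact hp (eventually_atBot.2 ⟨k, fun n hn c hc ↦ h n hn c hc⟩)
  constructor
  · filter_upwards [eventually_le_atBot N] with n hn hV
    obtain ⟨n', hn', c, hc, hc'⟩ := hex n
    obtain ⟨k, rfl⟩ : ∃ k : ℕ, n = n' + k := ⟨(n - n').toNat, by omega⟩
    obtain ⟨a, ha, -, hac⟩ := exists_smul_notMem_homogCoboundaries hS hN hc hc' k (by omega)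
    have := smul_mem_homogCocycles hc ha
    rw [add_comm] at this
    exact hac (hV this)
  · intro hle
    -- Otherwise the k-th power of R₊ kills the cohomology, yet a class of degree at most N - k
    -- survives some product of k generators.
    obtain ⟨k, hk⟩ := Ideal.exists_pow_le_of_le_radical_of_fg hle (IsNoetherian.noetherian _)
    obtain ⟨n, hn, c, hc, hc'⟩ := hex (N - k)
    obtain ⟨a, ha, hak, hac⟩ := exists_smul_notMem_homogCoboundaries hS hN hc hc' k (by omega)
    rw [← hirr] at hak
    have h0 := Module.mem_annihilator.1 (hk hak) (Submodule.Quotient.mk ⟨c, hc.1.1, hc.2⟩)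
    rw [← Submodule.Quotient.mk_smul, Submodule.Quotient.mk_eq_zero] at h0
    have hmem := smul_mem_homogCocycles hc ha
    rw [add_comm] at hmem
    exact hac (mem_homogCoboundaries_of_mem_coboundaries hx ℳ h0 hmem.1.2)

end Annihilator

end Cech

lemma iInf_natCast_eq_of_forall_lt {s : Set ℕ} {g : ℕ} (hg : g ∈ s) (h : ∀ i < g, i ∉ s) :
    ⨅ i ∈ s, (i : ℕ∞) = g :=
  le_antisymm (iInf₂_le g hg) (le_iInf₂ fun i hi ↦
    Nat.cast_le.2 (not_lt.1 fun hlt ↦ h i hlt hi))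

/-- `H^i_𝔞(M)` is `Cech.H x M i`, graded by `Cech.component x 𝒜 ℳ i`, for an arbitrary system `x`
of homogeneous generators of `𝔞 = 𝔞₀R + R₊`. -/
theorem proposition2p1 {R : Type*} [CommRing R] [IsNoetherianRing R]
    (𝒜 : ℕ → AddSubgroup R) [GradedRing 𝒜]
    [IsNoetherianRing (𝒜 0)] [IsLocalRing (𝒜 0)]
    (hgen : ∃ S : Finset R, (S : Set R) ⊆ 𝒜 1 ∧ Algebra.adjoin (𝒜 0) (S : Set R) = ⊤)
    (a₀ : Ideal (𝒜 0)) (ha₀ : a₀ ≠ ⊤)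
    {M : Type*} [AddCommGroup M] [Module R M] [Module.Finite R M] [Nontrivial M]
    (ℳ : ℤ → AddSubgroup M) [DirectSum.Decomposition ℳ] [GradedAction 𝒜 ℳ]
    {r : ℕ} (x : Fin r → R) (hx : IsHomogeneousGenerators 𝒜 x (idealAddIrrelevant 𝒜 a₀)) :
    (∀ f : ℕ, Cech.relFinitenessDim x M 𝒜 = f →
      ∀ᶠ n : ℤ in Filter.atBot, Cech.component x 𝒜 ℳ f n ≠ ⊥) ∧
    Cech.relFinitenessDim x M 𝒜 =
      ⨅ i ∈ {i : ℕ | ∀ᶠ n : ℤ in Filter.atBot, Cech.component x 𝒜 ℳ i n ≠ ⊥}, (i : ℕ∞) := by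
  obtain ⟨S, hS, hadj⟩ := hgen
  have hirr := irrelevant_eq_span_of_adjoin_eq_top 𝒜 hS hadj
  have hSx : (S : Set R) ⊆ Ideal.span (Set.range x) := by
    rw [hx.span_eq, idealAddIrrelevant, hirr]
    exact fun s hs ↦ Ideal.mem_sup_right (Ideal.subset_span hs)
  have hxh := hx.homogeneous
  simp only [ne_eq, Cech.component_eq_bot_iff hxh ℳ]
  have hrad : ∀ i, (∀ᶠ n in Filter.atBot, Cech.VanishesAt x 𝒜 ℳ i n) →
      (HomogeneousIdeal.irrelevant 𝒜).toIdeal ≤ (Module.annihilator R (Cech.H x M i)).radical :=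
    fun i ↦ Cech.irrelevant_le_radical_annihilator hxh hS hirr.le
      (Cech.eventually_atTop_vanishesAt hxh hS hirr.le hSx ℳ i)
  have hnot : ∀ i, (∀ᶠ n in Filter.atBot, Cech.VanishesAt x 𝒜 ℳ i n) →
      ¬ ∀ᶠ n in Filter.atBot, ¬ Cech.VanishesAt x 𝒜 ℳ i n := fun i h h' ↦ by
    obtain ⟨n, hn, hn'⟩ := (h.and h').exists
    exact hn' hn
  by_cases hall : ∀ i, ∀ᶠ n in Filter.atBot, Cech.VanishesAt x 𝒜 ℳ i n
  · have htop : Cech.relFinitenessDim x M 𝒜 = ⊤ :=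
      iInf₂_eq_top.2 fun i hi ↦ absurd (hrad i (hall i)) hi
    rw [htop]
    exact ⟨fun f hf ↦ absurd hf.symm (ENat.natCast_ne_top f),
      (iInf₂_eq_top.2 fun i hi ↦ absurd hi (hnot i (hall i))).symm⟩
  · classical
    rw [not_forall] at hall
    -- The least level without vanishing in low degrees turns out to be the value of both infima.
    have hlt : ∀ i < Nat.find hall, ∀ᶠ n in Filter.atBot, Cech.VanishesAt x 𝒜 ℳ i n :=
      fun i hi ↦ not_not.1 (Nat.find_min hall hi)
    obtain ⟨hev, hnle⟩ := Cech.eventually_not_vanishesAt_and_not_irrelevant_le hxh hS hirr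
      (Cech.eventually_atBot_mem_homogCoboundaries_of_smul_mem hxh hS hirr.le _ M ℳ hlt)
      (Nat.find_spec hall)
    have hf : Cech.relFinitenessDim x M 𝒜 = (Nat.find hall : ℕ) :=
      iInf_natCast_eq_of_forall_lt hnle fun i hi h ↦ h (hrad i (hlt i hi))
    refine ⟨fun f hff ↦ ?_, ?_⟩
    · rw [hf, Nat.cast_inj] at hff
      exact hff ▸ hev
    · exact hf.trans (iInf_natCast_eq_of_forall_lt hev fun i hi ↦ hnot i (hlt i hi)).symm
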